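/- Let $N\ge 2$ and let $\kappa$ be real with $\kappa>-\frac1N$. For a polynomial $f$ in $x=(x_1,\dots,x_N)$ with real coefficients let \[T_if(x)=\frac{\partial f}{\partial x_i}(x)+\kappa\sum_{j\ne i}\frac{f(x)-f(x(i,j))}{x_i-x_j}\qquad(1\le i\le N),\] where $x(i,j)$ is $x$ with the entries $x_i,x_j$ interchanged. Define polynomials $p_n(x_i;x)$ by $\sum_{n\ge0}p_n(x_i;x)r^n=(1-rx_i)^{-1}\prod_{j=1}^N(1-rx_j)^{-\kappa}$. Define $\phi_{nj},\psi_{nj}$ by expanding the formal power series \[\frac{1-st(p_1+p_2)+t^2p_1p_2}{(1-2stp_1+t^2p_1^2)(1-2stp_2+t^2p_2^2)}=\sum_{n,j}t^ns^j\phi_{nj},\qquad \frac{t(p_1-p_2)}{(1-2stp_1+t^2p_1^2)(1-2stp_2+t^2p_2^2)}=\sum_{n,j}t^ns^j\psi_{nj}\] in the indeterminates $p_1,p_2,s,t$, and then replacing each monomial $p_1^kp_2^l$ by $p_k(x_1;x)\,p_l(x_2;x)$. Let $g_0^o=g_0^e=1$ and, for $n\ge0$ (the last terms being $0$ for $n=0$),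 \[g_{n+1}^o(v)=(v+3n+1)g_n^o(v)-n(2n-1)g_{n-1}^o(v),\qquad g_{n+1}^e(v)=(v+3n+2)g_n^e(v)-n(2n+1)g_{n-1}^e(v).\] With $(a)_j=a(a+1)\cdots(a+j-1)$ set, for $m\ge0$, \begin{align*} h_{2m+1}^-&=\sum_{j=0}^m2^{-j}\frac{g_j^o(N\kappa-\kappa+m)}{(N\kappa+m+2)_j}\psi_{2m+1,2j},& h_{2m}^-&=\sum_{j=0}^{m-1}2^{-j}\frac{g_j^e(N\kappa-\kappa+m)}{(N\kappa+m+2)_j}\psi_{2m,2j+1},\\ h_{2m+1}^+&=\sum_{j=0}^m2^{-j}\frac{g_j^e(N\kappa-\kappa+m+1)}{(N\kappa+m+2)_j}\phi_{2m+1,2j+1},& h_{2m}^+&=\sum_{j=0}^m2^{-j}\frac{g_j^o(N\kappa-\kappa+m)}{(N\kappa+m+1)_j}\phi_{2m,2j}. \end{align*} Then the following identities hold, those for $T_1\pm T_2$ applied to $h_{2m+1}^{\pm}$ for all $m\ge0$ and those applied to $h_{2m}^{\pm}$ for all $m\ge1$: \begin{align*} (T_1-T_2)h_{2m+1}^-&=2(N\kappa+m+1)h_{2m}^+,&(T_1-T_2)h_{2m}^-&=2(N\kappa+m+1)h_{2m-1}^+,\\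 (T_1+T_2)h_{2m+1}^-&=(N\kappa-\kappa+m)h_{2m}^-,&(T_1+T_2)h_{2m}^-&=2(N\kappa+m+1)h_{2m-1}^-,\\ (T_1-T_2)h_{2m+1}^+&=-(N\kappa-\kappa+m)h_{2m}^-,&(T_1-T_2)h_{2m}^+&=-(N\kappa-\kappa+m)h_{2m-1}^-,\\ (T_1+T_2)h_{2m+1}^+&=2(N\kappa+m+1)h_{2m}^+,&(T_1+T_2)h_{2m}^+&=(N\kappa-\kappa+m)h_{2m-1}^+. \end{align*} -/

import Mathlib

/-! Type-A Dunkl operators on `ℝ[x_1, …, x_N]`, the `p`-basis, and the planar harmonic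
polynomials `h_n^±`. The variables `x_1, …, x_N` are `MvPolynomial.X i`, `i : Fin N`. -/

noncomputable section

namespace PlanarDunkl

open MvPolynomial

variable {N : ℕ}

/-- `f(x) - f(x(i,j))` is divisible by `x_i - x_j`. -/
theorem X_sub_X_dvd (i j : Fin N) (f : MvPolynomial (Fin N) ℝ) :
    (X i - X j : MvPolynomial (Fin N) ℝ) ∣ f - rename (Equiv.swap i j) f := by
  induction f using MvPolynomial.induction_on with
  | C a => simp
  | add p q hp hq =>
    have h := dvd_add hp hq
    rw [map_add]
    convert h using 1
    ring
  | mul_X p k hp =>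
    have hk : (X i - X j : MvPolynomial (Fin N) ℝ) ∣ X k - X (Equiv.swap i j k) := by
      rcases eq_or_ne k i with rfl | hi
      · simp
      · rcases eq_or_ne k j with rfl | hj
        · rw [Equiv.swap_apply_right]
          exact ⟨-1, by ring⟩
        · rw [Equiv.swap_apply_of_ne_of_ne hi hj]
          simp
    have h := dvd_add (hp.mul_right (X k)) (hk.mul_left (rename (Equiv.swap i j) p))
    rw [map_mul, rename_X]
    convert h using 1
    ring

/-- The polynomial `(f(x) - f(x(i,j))) / (x_i - x_j)` (only used for `i ≠ j`). -/
def divDiff (i j : Fin N) (f : MvPolynomial (Fin N) ℝ) : MvPolynomial (Fin N) ℝ :=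
  Classical.choose (X_sub_X_dvd i j f)

/-- The defining property of `divDiff`, which determines it for `i ≠ j`. -/
theorem mul_divDiff (i j : Fin N) (f : MvPolynomial (Fin N) ℝ) :
    (X i - X j) * divDiff i j f = f - rename (Equiv.swap i j) f :=
  (Classical.choose_spec (X_sub_X_dvd i j f)).symm

/-- The Dunkl operator
`T_i f = ∂f/∂x_i + κ ∑_{j ≠ i} (f(x) - f(x(i,j))) / (x_i - x_j)`. -/
def T (κ : ℝ) (i : Fin N) (f : MvPolynomial (Fin N) ℝ) : MvPolynomial (Fin N) ℝ :=
  pderiv i f + C κ * ∑ j ∈ Finset.univ.erase i, divDiff i j f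

/-- The formal power series `(1 - r y)^α` in `r`. -/
def oneSubPow (y : MvPolynomial (Fin N) ℝ) (α : ℝ) : PowerSeries (MvPolynomial (Fin N) ℝ) :=
  PowerSeries.rescale (-y) (PowerSeries.binomialSeries (MvPolynomial (Fin N) ℝ) α)

/-- `p_n(x_i; x)`, the coefficient of `r^n` in `(1 - r x_i)^{-1} ∏_j (1 - r x_j)^{-κ}`. -/
def p (κ : ℝ) (i : Fin N) (n : ℕ) : MvPolynomial (Fin N) ℝ :=
  PowerSeries.coeff n (oneSubPow (X i) (-1) * ∏ j : Fin N, oneSubPow (X j) (-κ))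

/-- The inverse of the symbolic map `Ψ` on polynomials in two symbols `p_1, p_2`: the linear map
with `p_1^k p_2^l ↦ p_k(x_a; x) p_l(x_b; x)`. -/
def PsiInv (κ : ℝ) (a b : Fin N) :
    MvPolynomial (Fin 2) ℝ →ₗ[ℝ] MvPolynomial (Fin N) ℝ :=
  (basisMonomials (Fin 2) ℝ).constr ℝ fun e => p κ a (e 0) * p κ b (e 1)

/-- Polynomials in `s` over `ℝ[p_1, p_2]`; generating functions are power series in `t` over it. -/
abbrev SPoly : Type := Polynomial (MvPolynomial (Fin 2) ℝ)

/-- The symbol `p_1` as a power series in `t`. -/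
def P₁ : PowerSeries SPoly := PowerSeries.C (Polynomial.C (X 0))

/-- The symbol `p_2` as a power series in `t`. -/
def P₂ : PowerSeries SPoly := PowerSeries.C (Polynomial.C (X 1))

/-- The variable `s` as a power series in `t`. -/
def s : PowerSeries SPoly := PowerSeries.C Polynomial.X

/-- The variable `t`. -/
def t : PowerSeries SPoly := PowerSeries.X

/-- `(1 - 2 s t p_1 + t² p_1²)(1 - 2 s t p_2 + t² p_2²)`. -/
def den : PowerSeries SPoly :=
  (1 - 2 * s * t * P₁ + t ^ 2 * P₁ ^ 2) * (1 - 2 * s * t * P₂ + t ^ 2 * P₂ ^ 2)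

/-- `u_1 = (1 - s t (p_1 + p_2) + t² p_1 p_2) / den`; the constant term of `den` is `1`. -/
def u₁ : PowerSeries SPoly :=
  (1 - s * t * (P₁ + P₂) + t ^ 2 * P₁ * P₂) * PowerSeries.invOfUnit den 1

/-- `u_2 = t (p_1 - p_2) / den`. -/
def u₂ : PowerSeries SPoly :=
  t * (P₁ - P₂) * PowerSeries.invOfUnit den 1

/-- `φ_{nj}`, the coefficient of `t^n s^j` in `u_1`, as a polynomial in `x`. -/
def phi (κ : ℝ) (a b : Fin N) (n j : ℕ) : MvPolynomial (Fin N) ℝ :=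
  PsiInv κ a b ((PowerSeries.coeff n u₁).coeff j)

/-- `ψ_{nj}`, the coefficient of `t^n s^j` in `u_2`, as a polynomial in `x`. -/
def psi (κ : ℝ) (a b : Fin N) (n j : ℕ) : MvPolynomial (Fin N) ℝ :=
  PsiInv κ a b ((PowerSeries.coeff n u₂).coeff j)

/-- `g_0^o = 1`, `g_{n+1}^o(v) = (v + 3n + 1) g_n^o(v) - n (2n - 1) g_{n-1}^o(v)`. -/
def gOdd (v : ℝ) : ℕ → ℝ
  | 0 => 1
  | 1 => v + 1
  | n + 2 => (v + 3 * ((n : ℝ) + 1) + 1) * gOdd v (n + 1)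
      - ((n : ℝ) + 1) * (2 * ((n : ℝ) + 1) - 1) * gOdd v n

/-- `g_0^e = 1`, `g_{n+1}^e(v) = (v + 3n + 2) g_n^e(v) - n (2n + 1) g_{n-1}^e(v)`. -/
def gEven (v : ℝ) : ℕ → ℝ
  | 0 => 1
  | 1 => v + 2
  | n + 2 => (v + 3 * ((n : ℝ) + 1) + 2) * gEven v (n + 1)
      - ((n : ℝ) + 1) * (2 * ((n : ℝ) + 1) + 1) * gEven v n

/-- The Pochhammer symbol `(x)_j = x (x + 1) ⋯ (x + j - 1)`. -/
def poch (x : ℝ) (j : ℕ) : ℝ := (ascPochhammer ℝ j).eval x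

/-- The antisymmetric polynomials `h_n^-`, with `n = 2m` or `n = 2m + 1`. -/
def hMinus (κ : ℝ) (a b : Fin N) (n : ℕ) : MvPolynomial (Fin N) ℝ :=
  let m := n / 2
  if Even n then
    ∑ j ∈ Finset.range m,
      C ((1 / 2) ^ j * gEven (N * κ - κ + m) j / poch (N * κ + m + 2) j) *
        psi κ a b (2 * m) (2 * j + 1)
  else
    ∑ j ∈ Finset.range (m + 1),
      C ((1 / 2) ^ j * gOdd (N * κ - κ + m) j / poch (N * κ + m + 2) j) *
        psi κ a b (2 * m + 1) (2 * j)

/-- The symmetric polynomials `h_n^+`, with `n = 2m` or `n = 2m + 1`. -/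
def hPlus (κ : ℝ) (a b : Fin N) (n : ℕ) : MvPolynomial (Fin N) ℝ :=
  let m := n / 2
  if Even n then
    ∑ j ∈ Finset.range (m + 1),
      C ((1 / 2) ^ j * gOdd (N * κ - κ + m) j / poch (N * κ + m + 1) j) *
        phi κ a b (2 * m) (2 * j)
  else
    ∑ j ∈ Finset.range (m + 1),
      C ((1 / 2) ^ j * gEven (N * κ - κ + m + 1) j / poch (N * κ + m + 2) j) *
        phi κ a b (2 * m + 1) (2 * j + 1)

end PlanarDunkl

end

noncomputable section

namespace PlanarDunkl

/-! ### Identities for Chebyshev polynomials -/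

section ChebyshevIdentities

open Polynomial

/-! Write `a`, `b` for the two distinguished indices. On products, `T_a` sends `p_k(x_a) p_l(x_b)`
to `(Nκ + k) p_{k-1}(x_a) p_l(x_b)` plus `κ` times a correction `(x_a - x_b) δ_k δ_l`. `T_b` lowers
`l` in the same way, with the opposite correction. So the correction cancels in `T_a + T_b` and
doubles in `T_a - T_b` (`T_p_mul_p`, `corr_swap`).

The generating functions expand as `∑ t^{k+l} p_1^k p_2^l T_{k-l}(s)` and `∑ t^{k+l} p_1^k p_2^l
U_{k-l-1}(s)`, with `T`, `U` the Chebyshev polynomials (`u₁_eq`, `u₂_eq`). For fixed `k + l = n` the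
lowering part therefore replaces the coefficient at `d = k - l` by `A T_{d+1} ± B T_{d-1}` (or its
analogue for `U`), where `A - B = d` and `A + B = 2Nκ + n + 2`. Chebyshev identities trade the
factor `d` for `d/ds`. The corrections vanish for `ψ` by parity; for `φ`, since `2 T_d = U_d -
U_{d-2}`, summation by parts turns them into `ψ`. Hence `T_a ± T_b` maps each `φ_{nj}`, `ψ_{nj}` to
at most two terms of degree `n - 1`.

Summing against the weights of `h_n^±`, the Pochhammer factors absorb the linear coefficients, and
contiguous relations between `g^o` and `g^e` (at `v`, `v ± 1`) give the target weights. Terms beyond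
the range vanish because of the degree of `T_d` and `U_{d-1}` in `s`. The bound on `κ` keeps the
Pochhammer symbols positive. -/

theorem coeff_X_mul_derivative (q : ℝ[X]) (j : ℕ) :
    (X * derivative q).coeff j = j * q.coeff j := by
  cases j with
  | zero => simp
  | succ j => rw [coeff_X_mul, coeff_derivative]; push_cast; ring

theorem T_add_one_eq (d : ℤ) :
    Chebyshev.T ℝ (d + 1) = X * Chebyshev.T ℝ d - (1 - X ^ 2) * Chebyshev.U ℝ (d - 1) := by
  have h := Chebyshev.T_eq_X_mul_T_sub_pol_U ℝ (d - 1)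
  rwa [sub_add_cancel, show d - 1 + 2 = d + 1 by ring] at h

theorem T_sub_one_eq (d : ℤ) :
    Chebyshev.T ℝ (d - 1) = X * Chebyshev.T ℝ d + (1 - X ^ 2) * Chebyshev.U ℝ (d - 1) := by
  rw [Chebyshev.T_sub_one, T_add_one_eq]
  ring

theorem U_self_eq (d : ℤ) :
    Chebyshev.U ℝ d = X * Chebyshev.U ℝ (d - 1) + Chebyshev.T ℝ d := by
  have h := Chebyshev.U_eq_X_mul_U_add_T ℝ (d - 1)
  rwa [sub_add_cancel] at h

theorem U_sub_two_eq (d : ℤ) :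
    Chebyshev.U ℝ (d - 2) = X * Chebyshev.U ℝ (d - 1) - Chebyshev.T ℝ d := by
  rw [Chebyshev.U_sub_two, U_self_eq d]
  ring

theorem cast_mul_T_eq (d : ℤ) :
    (C (d : ℝ) : ℝ[X]) * Chebyshev.T ℝ d = X * Chebyshev.U ℝ (d - 1)
      - (1 - X ^ 2) * derivative (Chebyshev.U ℝ (d - 1)) := by
  have h := Chebyshev.add_one_mul_T_eq_poly_in_U (R := ℝ) (d - 1)
  rw [sub_add_cancel] at h
  rw [← h]
  simp

theorem derivative_T_eq (d : ℤ) :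
    derivative (Chebyshev.T ℝ d) = C (d : ℝ) * Chebyshev.U ℝ (d - 1) := by
  rw [Chebyshev.T_derivative_eq_U]
  simp

variable {A B : ℝ} {d : ℤ}

/-- Expanding `T_{d±1} = s T_d ∓ (1 - s²) U_{d-1}` leaves `A - B = d` in front of `U_{d-1}`, and `d
U_{d-1} = T_d'`. The result involves `A`, `B` only through `A + B`, which is constant along `k + l =
n`. The nested products by `X` make coefficients readable with `coeff_X_mul`. -/
theorem T_combination_add (h : A - B = d) :
    C A * Chebyshev.T ℝ (d + 1) + C B * Chebyshev.T ℝ (d - 1)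
      = C (A + B) * (X * Chebyshev.T ℝ d) - (derivative (Chebyshev.T ℝ d)
        - X * (X * derivative (Chebyshev.T ℝ d))) := by
  have hC : (C (d : ℝ) : ℝ[X]) = C A - C B := by rw [← h, map_sub]
  rw [T_add_one_eq, T_sub_one_eq, derivative_T_eq, hC, map_add]
  ring

theorem T_combination_sub (h : A - B = d) :
    C A * Chebyshev.T ℝ (d + 1) - C B * Chebyshev.T ℝ (d - 1)
      = C (A + B + 1) * (X * (X * Chebyshev.U ℝ (d - 1))) - C (A + B) * Chebyshev.U ℝ (d - 1)
        - (X * derivative (Chebyshev.U ℝ (d - 1))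
          - X * (X * (X * derivative (Chebyshev.U ℝ (d - 1))))) := by
  have hC : (C (d : ℝ) : ℝ[X]) = C A - C B := by rw [← h, map_sub]
  have hT := cast_mul_T_eq d
  rw [hC] at hT
  rw [T_add_one_eq, T_sub_one_eq, map_add, map_add, map_one]
  linear_combination X * hT

theorem U_combination_add (h : A - B = d) :
    C A * Chebyshev.U ℝ d + C B * Chebyshev.U ℝ (d - 2)
      = C (A + B + 1) * (X * Chebyshev.U ℝ (d - 1)) - (derivative (Chebyshev.U ℝ (d - 1))
        - X * (X * derivative (Chebyshev.U ℝ (d - 1)))) := by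
  have hC : (C (d : ℝ) : ℝ[X]) = C A - C B := by rw [← h, map_sub]
  have hT := cast_mul_T_eq d
  rw [hC] at hT
  rw [U_self_eq d, U_sub_two_eq, map_add, map_add, map_one]
  linear_combination hT

theorem U_combination_sub (h : A - B = d) :
    C A * Chebyshev.U ℝ d - C B * Chebyshev.U ℝ (d - 2)
      = C (A + B) * Chebyshev.T ℝ d + X * derivative (Chebyshev.T ℝ d) := by
  have hC : (C (d : ℝ) : ℝ[X]) = C A - C B := by rw [← h, map_sub]
  rw [U_self_eq d, U_sub_two_eq, derivative_T_eq, hC, map_add]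
  ring

end ChebyshevIdentities

open MvPolynomial

variable {N : ℕ}

/-! ### The Dunkl operators as linear maps -/

/-- Cancellation in a domain identifies the chosen quotient; divided differences below are computed
by exhibiting a candidate. -/
theorem divDiff_eq_of_mul_eq {i j : Fin N} (hij : i ≠ j) {f g : MvPolynomial (Fin N) ℝ}
    (h : (X i - X j) * g = f - rename (Equiv.swap i j) f) : divDiff i j f = g := by
  have h0 : (X i - X j : MvPolynomial (Fin N) ℝ) ≠ 0 :=
    sub_ne_zero.2 fun h => hij (X_injective h)
  exact mul_left_cancel₀ h0 ((mul_divDiff i j f).trans h.symm)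

theorem divDiff_add {i j : Fin N} (hij : i ≠ j) (f g : MvPolynomial (Fin N) ℝ) :
    divDiff i j (f + g) = divDiff i j f + divDiff i j g :=
  divDiff_eq_of_mul_eq hij (by rw [mul_add, mul_divDiff, mul_divDiff, map_add]; ring)

theorem divDiff_smul {i j : Fin N} (hij : i ≠ j) (c : ℝ) (f : MvPolynomial (Fin N) ℝ) :
    divDiff i j (c • f) = c • divDiff i j f :=
  divDiff_eq_of_mul_eq hij (by rw [mul_smul_comm, mul_divDiff, map_smul, smul_sub])

/-- The Dunkl operator `T κ i` as a linear map. -/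
def dunkl (κ : ℝ) (i : Fin N) : MvPolynomial (Fin N) ℝ →ₗ[ℝ] MvPolynomial (Fin N) ℝ where
  toFun := T κ i
  map_add' f g := by
    have : ∑ j ∈ Finset.univ.erase i, divDiff i j (f + g)
        = ∑ j ∈ Finset.univ.erase i, divDiff i j f + ∑ j ∈ Finset.univ.erase i, divDiff i j g := by
      rw [← Finset.sum_add_distrib]
      exact Finset.sum_congr rfl fun j hj => divDiff_add (Finset.ne_of_mem_erase hj).symm f g
    rw [T, T, T, this, map_add]
    ring
  map_smul' c f := by
    have : ∑ j ∈ Finset.univ.erase i, divDiff i j (c • f)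
        = c • ∑ j ∈ Finset.univ.erase i, divDiff i j f := by
      rw [Finset.smul_sum]
      exact Finset.sum_congr rfl fun j hj => divDiff_smul (Finset.ne_of_mem_erase hj).symm c f
    rw [T, T, this, Derivation.map_smul, RingHom.id_apply, smul_add, mul_smul_comm]

/-! ### Power series identities for `(1 - r y)^α` -/

theorem choose_succ_mul (α : ℝ) (n : ℕ) :
    Ring.choose α (n + 1) * (n + 1) = Ring.choose α n * (α - n) := by
  have h1 := Ring.descPochhammer_eq_factorial_smul_choose α (n + 1)
  have h2 := Ring.descPochhammer_eq_factorial_smul_choose α n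
  rw [descPochhammer_succ_right, Polynomial.smeval_mul, h2] at h1
  have h3 : (Polynomial.X - (n : Polynomial ℤ)).smeval α = α - n := by
    simp [Polynomial.smeval_sub, Polynomial.smeval_X, Polynomial.smeval_natCast]
  rw [h3, Nat.factorial_succ] at h1
  simp only [nsmul_eq_mul, Nat.cast_mul, Nat.cast_add, Nat.cast_one] at h1
  have h4 : (n.factorial : ℝ) ≠ 0 := by positivity
  apply mul_left_cancel₀ h4
  linear_combination -h1

theorem coeff_oneSubPow (y : MvPolynomial (Fin N) ℝ) (α : ℝ) (n : ℕ) :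
    PowerSeries.coeff n (oneSubPow y α) = C ((-1) ^ n * Ring.choose α n) * y ^ n := by
  rw [oneSubPow, PowerSeries.coeff_rescale, PowerSeries.binomialSeries_coeff, neg_pow,
    MvPolynomial.smul_eq_C_mul, map_mul]
  simp
  ring

/-- Coefficient form of `(1 - r y) F' = α y F`; both the `r`-derivative and the `x_i`-derivative are
read off from it. -/
theorem coeff_oneSubPow_neg_succ (y : MvPolynomial (Fin N) ℝ) (α : ℝ) (n : ℕ) :
    PowerSeries.coeff (n + 1) (oneSubPow y (-α)) * ((n : MvPolynomial (Fin N) ℝ) + 1)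
      = (C α + (n : MvPolynomial (Fin N) ℝ)) * y * PowerSeries.coeff n (oneSubPow y (-α)) := by
  have h : (-1) ^ (n + 1) * Ring.choose (-α) (n + 1) * (n + 1)
      = (α + n) * ((-1) ^ n * Ring.choose (-α) n) := by
    linear_combination (-1) ^ (n + 1) * choose_succ_mul (-α) n
  have h' := congrArg (C : ℝ → MvPolynomial (Fin N) ℝ) h
  rw [map_mul, map_mul C (α + n)] at h'
  simp only [map_add, map_natCast, map_one] at h'
  rw [coeff_oneSubPow, coeff_oneSubPow]
  linear_combination y ^ (n + 1) * h'

/-- `1 - r x_i`. -/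
def lin (i : Fin N) : PowerSeries (MvPolynomial (Fin N) ℝ) :=
  1 - PowerSeries.C (X i) * PowerSeries.X

theorem coeff_zero_lin_mul (i : Fin N) (f : PowerSeries (MvPolynomial (Fin N) ℝ)) :
    PowerSeries.coeff 0 (lin i * f) = PowerSeries.coeff 0 f := by
  rw [lin, sub_mul, one_mul, mul_assoc, map_sub, PowerSeries.coeff_C_mul]
  simp

theorem coeff_succ_lin_mul (i : Fin N) (f : PowerSeries (MvPolynomial (Fin N) ℝ)) (n : ℕ) :
    PowerSeries.coeff (n + 1) (lin i * f)
      = PowerSeries.coeff (n + 1) f - X i * PowerSeries.coeff n f := by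
  rw [lin, sub_mul, one_mul, mul_assoc, map_sub, PowerSeries.coeff_C_mul,
    PowerSeries.coeff_succ_X_mul]

theorem lin_ne_zero (i : Fin N) : lin i ≠ 0 := by
  intro h
  have := congrArg (PowerSeries.coeff 0) h
  simp [lin] at this

theorem lin_mul_oneSubPow_neg_one (i : Fin N) : lin i * oneSubPow (X i) (-1) = 1 := by
  have hc : ∀ n : ℕ, (-1) ^ n * Ring.choose (-1 : ℝ) n = 1 := by
    intro n
    induction n with
    | zero => simp
    | succ n ih =>
      have h := choose_succ_mul (-1) n
      have h0 : (n + 1 : ℝ) ≠ 0 := by positivity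
      apply mul_right_cancel₀ h0
      linear_combination (-1) ^ (n + 1) * h + (n + 1) * ih
  ext1 n
  cases n with
  | zero => rw [coeff_zero_lin_mul, coeff_oneSubPow, hc]; simp
  | succ n =>
    rw [coeff_succ_lin_mul, coeff_oneSubPow, coeff_oneSubPow, hc, hc, PowerSeries.coeff_one]
    simp [pow_succ']

/-- The derivation of a power series ring that acts on coefficients by a given derivation. -/
def coeffDerivation (D : Derivation ℝ (MvPolynomial (Fin N) ℝ) (MvPolynomial (Fin N) ℝ)) :
    Derivation ℝ (PowerSeries (MvPolynomial (Fin N) ℝ))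
      (PowerSeries (MvPolynomial (Fin N) ℝ)) :=
  Derivation.mk'
    { toFun := fun f => PowerSeries.mk fun n => D (PowerSeries.coeff n f)
      map_add' := fun f g => by ext1 n; simp
      map_smul' := fun c f => by ext1 n; simp }
    (fun f g => by
      ext1 n
      simp only [LinearMap.coe_mk, AddHom.coe_mk, PowerSeries.coeff_mk, smul_eq_mul, map_add,
        PowerSeries.coeff_mul, map_sum, Derivation.leibniz, Finset.sum_add_distrib]
      congr 1
      rw [← Finset.Nat.sum_antidiagonal_swap]
      rfl)

@[simp]
theorem coeff_coeffDerivation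
    (D : Derivation ℝ (MvPolynomial (Fin N) ℝ) (MvPolynomial (Fin N) ℝ))
    (f : PowerSeries (MvPolynomial (Fin N) ℝ)) (n : ℕ) :
    PowerSeries.coeff n (coeffDerivation D f) = D (PowerSeries.coeff n f) :=
  PowerSeries.coeff_mk n fun n => D (PowerSeries.coeff n f)

/-- Logarithmic derivatives add. -/
theorem derivation_prod_eq {A ι : Type*} [CommRing A] [Algebra ℝ A] (D : Derivation ℝ A A)
    (s : Finset ι) (f c : ι → A) (h : ∀ i ∈ s, D (f i) = c i * f i) :
    D (∏ i ∈ s, f i) = (∑ i ∈ s, c i) * ∏ i ∈ s, f i := by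
  classical
  induction s using Finset.induction_on with
  | empty => simp
  | insert i s hi ih =>
    rw [Finset.prod_insert hi, Finset.sum_insert hi, Derivation.leibniz,
      ih fun j hj => h j (Finset.mem_insert_of_mem hj), h i (Finset.mem_insert_self i s)]
    simp only [smul_eq_mul]
    ring

theorem lin_mul_derivative_oneSubPow (i : Fin N) (α : ℝ) :
    lin i * PowerSeries.derivative _ (oneSubPow (X i) (-α))
      = PowerSeries.C (C α * X i) * oneSubPow (X i) (-α) := by
  ext1 n
  rw [PowerSeries.coeff_C_mul]
  cases n with
  | zero =>
    rw [coeff_zero_lin_mul, PowerSeries.coeff_derivative]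
    have := coeff_oneSubPow_neg_succ (X i) α 0
    simpa using this
  | succ n =>
    rw [coeff_succ_lin_mul, PowerSeries.coeff_derivative, PowerSeries.coeff_derivative]
    have h1 := coeff_oneSubPow_neg_succ (X i) α (n + 1)
    push_cast at h1 ⊢
    linear_combination h1

theorem lin_mul_pderiv_oneSubPow (i : Fin N) (α : ℝ) :
    lin i * coeffDerivation (pderiv i) (oneSubPow (X i) (-α))
      = PowerSeries.X * (PowerSeries.C (C α) * oneSubPow (X i) (-α)) := by
  have hd : ∀ n, PowerSeries.coeff (n + 1) (coeffDerivation (pderiv i) (oneSubPow (X i) (-α)))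
      = (C α + (n : MvPolynomial (Fin N) ℝ)) * PowerSeries.coeff n (oneSubPow (X i) (-α)) := by
    intro n
    have h := coeff_oneSubPow_neg_succ (X i) α n
    rw [coeff_coeffDerivation]
    rw [coeff_oneSubPow, coeff_oneSubPow] at *
    rw [Derivation.leibniz, pderiv_C, smul_zero, add_zero, Derivation.leibniz_pow, pderiv_X_self]
    apply mul_left_cancel₀ (X_ne_zero i : (X i : MvPolynomial (Fin N) ℝ) ≠ 0)
    simp only [smul_eq_mul, nsmul_eq_mul, Nat.add_sub_cancel]
    push_cast
    linear_combination h
  have hd0 : PowerSeries.coeff 0 (coeffDerivation (pderiv i) (oneSubPow (X i) (-α))) = 0 := by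
    rw [coeff_coeffDerivation, coeff_oneSubPow, pow_zero (X i), mul_one, pderiv_C]
  ext1 n
  cases n with
  | zero => rw [coeff_zero_lin_mul, hd0]; simp
  | succ n =>
    rw [PowerSeries.coeff_succ_X_mul, PowerSeries.coeff_C_mul, coeff_succ_lin_mul, hd]
    cases n with
    | zero => rw [hd0]; simp
    | succ n =>
      rw [hd]
      have h := coeff_oneSubPow_neg_succ (X i) α n
      push_cast
      linear_combination h

theorem pderiv_oneSubPow_of_ne {i j : Fin N} (h : j ≠ i) (α : ℝ) :
    coeffDerivation (pderiv i) (oneSubPow (X j) α) = 0 := by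
  ext1 n
  rw [coeff_coeffDerivation, coeff_oneSubPow, Derivation.leibniz, Derivation.leibniz_pow,
    pderiv_X_of_ne h]
  simp

/-! ### The Dunkl operators on the `p`-basis -/

/-- `A_i = (1 - r x_i)^{-1}`. -/
abbrev geom (i : Fin N) : PowerSeries (MvPolynomial (Fin N) ℝ) := oneSubPow (X i) (-1)

/-- `E = ∏_j (1 - r x_j)^{-κ}`. -/
def symGen (N : ℕ) (κ : ℝ) : PowerSeries (MvPolynomial (Fin N) ℝ) :=
  ∏ j : Fin N, oneSubPow (X j) (-κ)

/-- The generating function of the `p_n(x_i; x)`. -/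
def pGen (κ : ℝ) (i : Fin N) : PowerSeries (MvPolynomial (Fin N) ℝ) :=
  geom i * symGen N κ

theorem p_eq_coeff (κ : ℝ) (i : Fin N) (n : ℕ) : p κ i n = PowerSeries.coeff n (pGen κ i) := rfl

theorem geom_eq (i : Fin N) :
    geom i = 1 + PowerSeries.X * (PowerSeries.C (X i) * geom i) := by
  have h := lin_mul_oneSubPow_neg_one i
  rw [lin] at h
  linear_combination h

theorem eq_geom_mul_of_lin_mul_eq {i : Fin N} {f g : PowerSeries (MvPolynomial (Fin N) ℝ)}
    (h : lin i * f = g) : f = geom i * g := by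
  apply mul_left_cancel₀ (lin_ne_zero i)
  linear_combination h - g * lin_mul_oneSubPow_neg_one i

theorem lin_mul_pGen (κ : ℝ) (i : Fin N) : lin i * pGen κ i = symGen N κ := by
  rw [pGen, ← mul_assoc, lin_mul_oneSubPow_neg_one, one_mul]

theorem p_zero (κ : ℝ) (i : Fin N) : p κ i 0 = PowerSeries.coeff 0 (symGen N κ) := by
  rw [p_eq_coeff, ← lin_mul_pGen κ i, coeff_zero_lin_mul]

theorem p_succ (κ : ℝ) (i : Fin N) (n : ℕ) :
    p κ i (n + 1) = X i * p κ i n + PowerSeries.coeff (n + 1) (symGen N κ) := by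
  rw [p_eq_coeff, p_eq_coeff, ← lin_mul_pGen κ i, coeff_succ_lin_mul]
  ring

theorem map_rename_oneSubPow (σ : Equiv.Perm (Fin N)) (i : Fin N) (α : ℝ) :
    PowerSeries.map (rename σ : MvPolynomial (Fin N) ℝ →ₐ[ℝ] MvPolynomial (Fin N) ℝ).toRingHom
      (oneSubPow (X i) α) = oneSubPow (X (σ i)) α := by
  ext1 n
  rw [PowerSeries.coeff_map, coeff_oneSubPow, coeff_oneSubPow]
  simp

theorem rename_p (κ : ℝ) (σ : Equiv.Perm (Fin N)) (i : Fin N) (n : ℕ) :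
    rename σ (p κ i n) = p κ (σ i) n := by
  have h : PowerSeries.map
      (rename σ : MvPolynomial (Fin N) ℝ →ₐ[ℝ] MvPolynomial (Fin N) ℝ).toRingHom
      (pGen κ i) = pGen κ (σ i) := by
    rw [pGen, pGen, symGen, map_mul, map_prod, map_rename_oneSubPow]
    congr 1
    rw [← Equiv.prod_comp σ fun j => oneSubPow (X j) (-κ)]
    exact Finset.prod_congr rfl fun j _ => map_rename_oneSubPow σ j _
  rw [p_eq_coeff κ (σ i), ← h, PowerSeries.coeff_map]
  rfl

theorem mul_divDiff_p (κ : ℝ) (i j : Fin N) (n : ℕ) :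
    (X i - X j) * divDiff i j (p κ i n) = p κ i n - p κ j n := by
  rw [mul_divDiff, rename_p, Equiv.swap_apply_left]

theorem divDiff_p_eq_of_mul_eq {κ : ℝ} {i j : Fin N} (hij : i ≠ j) {n : ℕ}
    {g : MvPolynomial (Fin N) ℝ} (h : (X i - X j) * g = p κ i n - p κ j n) :
    divDiff i j (p κ i n) = g :=
  divDiff_eq_of_mul_eq hij (by rw [h, rename_p, Equiv.swap_apply_left])

theorem divDiff_p_zero (κ : ℝ) {i j : Fin N} (hij : i ≠ j) : divDiff i j (p κ i 0) = 0 :=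
  divDiff_p_eq_of_mul_eq hij (by rw [p_zero, p_zero]; ring)

/-- In `p_{n+1}(x_i) = x_i p_n(x_i) + e_{n+1}` the term `e_{n+1}` does not depend on `i`, so it
drops out of differences. -/
theorem divDiff_p_succ (κ : ℝ) {i j : Fin N} (hij : i ≠ j) (n : ℕ) :
    divDiff i j (p κ i (n + 1)) = p κ i n + X j * divDiff i j (p κ i n) :=
  divDiff_p_eq_of_mul_eq hij (by
    rw [p_succ, p_succ]
    linear_combination X j * mul_divDiff_p κ i j n)

theorem mk_divDiff_p (κ : ℝ) {i j : Fin N} (hij : i ≠ j) :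
    (PowerSeries.mk fun n => divDiff i j (p κ i n)) = PowerSeries.X * (geom j * pGen κ i) := by
  have h : lin j * (PowerSeries.mk fun n => divDiff i j (p κ i n)) = PowerSeries.X * pGen κ i := by
    ext1 n
    cases n with
    | zero => rw [coeff_zero_lin_mul, PowerSeries.coeff_mk, divDiff_p_zero κ hij]; simp
    | succ n =>
      rw [coeff_succ_lin_mul, PowerSeries.coeff_mk, PowerSeries.coeff_mk, divDiff_p_succ κ hij,
        PowerSeries.coeff_succ_X_mul, p_eq_coeff]
      ring
  rw [eq_geom_mul_of_lin_mul_eq h]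
  ring

/-! ### Derivatives of the generating functions, in `r` and in `x_i` -/

theorem derivative_oneSubPow (i : Fin N) (α : ℝ) :
    PowerSeries.derivative _ (oneSubPow (X i) (-α))
      = (PowerSeries.C (C α) * (PowerSeries.C (X i) * geom i)) * oneSubPow (X i) (-α) := by
  rw [eq_geom_mul_of_lin_mul_eq (lin_mul_derivative_oneSubPow i α), map_mul]
  ring

theorem pderiv_oneSubPow_self (i : Fin N) (α : ℝ) :
    coeffDerivation (pderiv i) (oneSubPow (X i) (-α))
      = (PowerSeries.C (C α) * (PowerSeries.X * geom i)) * oneSubPow (X i) (-α) := by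
  rw [eq_geom_mul_of_lin_mul_eq (lin_mul_pderiv_oneSubPow i α)]
  ring

theorem pderiv_symGen (κ : ℝ) (i : Fin N) :
    coeffDerivation (pderiv i) (symGen N κ)
      = PowerSeries.C (C κ) * (PowerSeries.X * geom i) * symGen N κ := by
  rw [symGen, derivation_prod_eq _ _ _
    (fun j => if j = i then PowerSeries.C (C κ) * (PowerSeries.X * geom i) else 0)]
  · simp
  · intro j _
    split_ifs with h
    · rw [h]; exact pderiv_oneSubPow_self i κ
    · rw [pderiv_oneSubPow_of_ne h, zero_mul]

theorem derivative_symGen (κ : ℝ) :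
    PowerSeries.derivative _ (symGen N κ)
      = PowerSeries.C (C κ) * (∑ j : Fin N, PowerSeries.C (X j) * geom j) * symGen N κ := by
  have h := derivation_prod_eq
    ((PowerSeries.derivative (MvPolynomial (Fin N) ℝ)).restrictScalars ℝ) Finset.univ
    (fun j : Fin N => oneSubPow (X j) (-κ))
    (fun j => PowerSeries.C (C κ) * (PowerSeries.C (X j) * geom j))
    (fun j _ => derivative_oneSubPow j κ)
  rw [← Finset.mul_sum] at h
  exact h

theorem pderiv_pGen_self (κ : ℝ) (i : Fin N) :
    coeffDerivation (pderiv i) (pGen κ i)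
      = (1 + PowerSeries.C (C κ)) * (PowerSeries.X * (geom i * pGen κ i)) := by
  have h := pderiv_oneSubPow_self i 1
  rw [pGen, Derivation.leibniz, pderiv_symGen, h]
  simp only [map_one, smul_eq_mul]
  ring

theorem pderiv_pGen_of_ne (κ : ℝ) {i j : Fin N} (h : j ≠ i) :
    coeffDerivation (pderiv i) (pGen κ j)
      = PowerSeries.C (C κ) * (PowerSeries.X * (geom j * pGen κ i)) := by
  rw [pGen, pGen, Derivation.leibniz, pderiv_symGen, pderiv_oneSubPow_of_ne h]
  simp only [smul_eq_mul]
  ring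

theorem derivative_pGen (κ : ℝ) (i : Fin N) :
    PowerSeries.derivative _ (pGen κ i) = (PowerSeries.C (X i) * geom i
      + PowerSeries.C (C κ) * ∑ j : Fin N, PowerSeries.C (X j) * geom j) * pGen κ i := by
  have h := derivative_oneSubPow i 1
  rw [pGen, Derivation.leibniz, derivative_symGen, h]
  simp only [map_one, smul_eq_mul]
  ring

/-- `∂_i` sees `p_n(x_j)` only through the symmetric factor, which contributes `κ r A_i`; both sides
have generating function `κ r A_i A_j E`. -/
theorem pderiv_p_of_ne (κ : ℝ) {i j : Fin N} (h : i ≠ j) (n : ℕ) :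
    pderiv i (p κ j n) = C κ * divDiff i j (p κ i n) := by
  rw [p_eq_coeff κ j, ← coeff_coeffDerivation, pderiv_pGen_of_ne κ h.symm, ← mk_divDiff_p κ h,
    PowerSeries.coeff_C_mul, PowerSeries.coeff_mk]

/-- The derivative and the divided differences combine to `r (A_i + κ ∑_j A_j) P_i`, where `P_i` is
`pGen κ i`. Substituting `A_j = 1 + r x_j A_j` separates the constant `1 + Nκ` from `r` times the
logarithmic `r`-derivative of `P_i`. -/
theorem mk_T_p (κ : ℝ) (i : Fin N) :
    (PowerSeries.mk fun n => T κ i (p κ i n))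
      = PowerSeries.X * (PowerSeries.C (C (1 + N * κ)) * pGen κ i
        + PowerSeries.X * PowerSeries.derivative _ (pGen κ i)) := by
  have h1 : (PowerSeries.mk fun n => T κ i (p κ i n))
      = coeffDerivation (pderiv i) (pGen κ i)
        + PowerSeries.C (C κ) * ∑ j ∈ Finset.univ.erase i,
          PowerSeries.mk fun n => divDiff i j (p κ i n) := by
    ext1 n
    rw [PowerSeries.coeff_mk, map_add, coeff_coeffDerivation, PowerSeries.coeff_C_mul, map_sum]
    simp only [PowerSeries.coeff_mk]
    rfl
  have h2 : ∑ j ∈ Finset.univ.erase i, (PowerSeries.mk fun n => divDiff i j (p κ i n))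
      = PowerSeries.X * ((∑ j : Fin N, geom j - geom i) * pGen κ i) := by
    rw [← Finset.sum_erase_eq_sub (Finset.mem_univ i), Finset.sum_mul, Finset.mul_sum]
    exact Finset.sum_congr rfl fun j hj => mk_divDiff_p κ (Finset.ne_of_mem_erase hj).symm
  have h3 : ∑ j : Fin N, geom j
      = (N : PowerSeries (MvPolynomial (Fin N) ℝ))
        + PowerSeries.X * ∑ j : Fin N, PowerSeries.C (X j) * geom j := by
    rw [Finset.sum_congr rfl fun j _ => geom_eq j, Finset.sum_add_distrib, ← Finset.mul_sum]
    simp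
  have h4 : PowerSeries.C (C (1 + N * κ) : MvPolynomial (Fin N) ℝ)
      = 1 + (N : PowerSeries (MvPolynomial (Fin N) ℝ)) * PowerSeries.C (C κ) := by
    simp only [map_add, map_mul, map_one, map_natCast]
  rw [h1, h2, pderiv_pGen_self, derivative_pGen, h3, h4]
  linear_combination PowerSeries.X * pGen κ i * geom_eq i

theorem T_p_zero (κ : ℝ) (i : Fin N) : T κ i (p κ i 0) = 0 := by
  have h := congrArg (PowerSeries.coeff 0) (mk_T_p κ i)
  simpa using h

theorem T_p_succ (κ : ℝ) (i : Fin N) (n : ℕ) :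
    T κ i (p κ i (n + 1)) = (N * κ + n + 1) • p κ i n := by
  have h := congrArg (PowerSeries.coeff (n + 1)) (mk_T_p κ i)
  rw [PowerSeries.coeff_mk, PowerSeries.coeff_succ_X_mul, map_add, PowerSeries.coeff_C_mul,
    ← p_eq_coeff] at h
  have h' : PowerSeries.coeff n (PowerSeries.X * PowerSeries.derivative _ (pGen κ i))
      = (n : MvPolynomial (Fin N) ℝ) * p κ i n := by
    cases n with
    | zero => simp
    | succ n =>
      rw [PowerSeries.coeff_succ_X_mul, PowerSeries.coeff_derivative, p_eq_coeff]
      push_cast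
      ring
  rw [h, h', smul_eq_C_mul]
  simp only [map_add, map_mul, map_one, map_natCast]
  ring

/-- The correction `(x_a - x_b) δ_k δ_l`, with `δ_k = (p_k(x_a) - p_k(x_b)) / (x_a - x_b)`. -/
def corr (κ : ℝ) (a b : Fin N) (k l : ℕ) : MvPolynomial (Fin N) ℝ :=
  (X a - X b) * (divDiff a b (p κ a k) * divDiff a b (p κ a l))

/-- For `j ≠ a, b` the swap fixes `p_l(x_b)`, which factors out. The quotient at `j = b` yields
`-p_k(x_a) δ_l`, cancelling `∂_a p_l(x_b) = κ δ_l`, and leaves the correction. -/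
theorem T_p_mul_p (κ : ℝ) {a b : Fin N} (h : a ≠ b) (k l : ℕ) :
    T κ a (p κ a k * p κ b l) = T κ a (p κ a k) * p κ b l + κ • corr κ a b k l := by
  have h1 : ∀ j ∈ (Finset.univ.erase a).erase b,
      divDiff a j (p κ a k * p κ b l) = divDiff a j (p κ a k) * p κ b l := by
    intro j hj
    simp only [Finset.mem_erase, Finset.mem_univ, and_true] at hj
    apply divDiff_eq_of_mul_eq hj.2.symm
    rw [map_mul, rename_p, rename_p, Equiv.swap_apply_left,
      Equiv.swap_apply_of_ne_of_ne h.symm hj.1.symm]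
    linear_combination p κ b l * mul_divDiff_p κ a j k
  have h2 : divDiff a b (p κ a k * p κ b l) = divDiff a b (p κ a k) * p κ b l
      - p κ a k * divDiff a b (p κ a l) + corr κ a b k l := by
    apply divDiff_eq_of_mul_eq h
    rw [map_mul, rename_p, rename_p, Equiv.swap_apply_left, Equiv.swap_apply_right, corr]
    have e1 := mul_divDiff_p κ a b k
    have e2 := mul_divDiff_p κ a b l
    linear_combination p κ b l * e1 - p κ a k * e2
      + (X a - X b) * divDiff a b (p κ a l) * e1 + (p κ a k - p κ b k) * e2
  have hb : b ∈ Finset.univ.erase a := by simp [h.symm]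
  rw [T, T, ← Finset.add_sum_erase _ _ hb, ← Finset.add_sum_erase _ _ hb,
    Finset.sum_congr rfl h1, h2, Derivation.leibniz, pderiv_p_of_ne κ h, ← Finset.sum_mul,
    smul_eq_C_mul]
  simp only [smul_eq_mul]
  ring

theorem divDiff_p_comm (κ : ℝ) {a b : Fin N} (h : a ≠ b) (k : ℕ) :
    divDiff b a (p κ b k) = divDiff a b (p κ a k) :=
  divDiff_p_eq_of_mul_eq h.symm (by linear_combination -mul_divDiff_p κ a b k)

theorem corr_comm (κ : ℝ) (a b : Fin N) (k l : ℕ) : corr κ a b k l = corr κ a b l k := by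
  rw [corr, corr, mul_comm (divDiff a b (p κ a k))]

theorem corr_swap (κ : ℝ) {a b : Fin N} (h : a ≠ b) (k l : ℕ) :
    corr κ b a k l = -corr κ a b k l := by
  rw [corr, corr, divDiff_p_comm κ h, divDiff_p_comm κ h]
  ring

theorem corr_zero_left (κ : ℝ) {a b : Fin N} (h : a ≠ b) (l : ℕ) : corr κ a b 0 l = 0 := by
  rw [corr, divDiff_p_zero κ h]
  ring

theorem corr_zero_right (κ : ℝ) {a b : Fin N} (h : a ≠ b) (k : ℕ) : corr κ a b k 0 = 0 := by
  rw [corr_comm, corr_zero_left κ h]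

/-- With `δ_{l+1} = p_l(x_a) + x_b δ_l`, the terms containing `x_b δ_k δ_l` cancel. This is the
telescoping step behind `corrSum_succ_eq`. -/
theorem corr_succ_sub_corr_succ (κ : ℝ) {a b : Fin N} (h : a ≠ b) (k l : ℕ) :
    corr κ a b k (l + 1) - corr κ a b (k + 1) l = p κ a k * p κ b l - p κ a l * p κ b k := by
  rw [corr, corr, divDiff_p_succ κ h, divDiff_p_succ κ h]
  linear_combination p κ a l * mul_divDiff_p κ a b k - p κ a k * mul_divDiff_p κ a b l

/-- The product `p_k(x_a) p_l(x_b)`. -/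
def pp (κ : ℝ) (a b : Fin N) (k l : ℕ) : MvPolynomial (Fin N) ℝ := p κ a k * p κ b l

theorem dunkl_left_pp_zero (κ : ℝ) {a b : Fin N} (h : a ≠ b) (l : ℕ) :
    dunkl κ a (pp κ a b 0 l) = κ • corr κ a b 0 l := by
  change T κ a (p κ a 0 * p κ b l) = _
  rw [T_p_mul_p κ h, T_p_zero, zero_mul, zero_add]

theorem dunkl_left_pp_succ (κ : ℝ) {a b : Fin N} (h : a ≠ b) (k l : ℕ) :
    dunkl κ a (pp κ a b (k + 1) l)
      = (N * κ + k + 1) • pp κ a b k l + κ • corr κ a b (k + 1) l := by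
  change T κ a (p κ a (k + 1) * p κ b l) = _
  rw [T_p_mul_p κ h, T_p_succ, smul_mul_assoc, pp]

theorem pp_swap (κ : ℝ) (a b : Fin N) (k l : ℕ) : pp κ a b k l = pp κ b a l k := mul_comm _ _

theorem dunkl_right_pp_zero (κ : ℝ) {a b : Fin N} (h : a ≠ b) (k : ℕ) :
    dunkl κ b (pp κ a b k 0) = -(κ • corr κ a b k 0) := by
  rw [pp_swap, dunkl_left_pp_zero κ h.symm, corr_swap κ h, corr_comm, smul_neg]

theorem dunkl_right_pp_succ (κ : ℝ) {a b : Fin N} (h : a ≠ b) (k l : ℕ) :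
    dunkl κ b (pp κ a b k (l + 1))
      = (N * κ + l + 1) • pp κ a b k l - κ • corr κ a b k (l + 1) := by
  rw [pp_swap, dunkl_left_pp_succ κ h.symm, corr_swap κ h, corr_comm, smul_neg, ← pp_swap,
    sub_eq_add_neg]

/-! ### Chebyshev expansion of the generating functions -/

/-- `∑_{k,l} t^{k+l} p_1^k p_2^l f(k - l)`. -/
def pairSeries (f : ℤ → SPoly) : PowerSeries SPoly :=
  PowerSeries.mk fun n => ∑ x ∈ Finset.HasAntidiagonal.antidiagonal n,
    Polynomial.C (X 0 ^ x.1 * X 1 ^ x.2) * f ((x.1 : ℤ) - x.2)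

/-- `∑_l t^l p_2^l f(-l)`. -/
def edgeSeries (f : ℤ → SPoly) : PowerSeries SPoly :=
  PowerSeries.mk fun n => Polynomial.C (X 1 ^ n) * f (-(n : ℤ))

theorem edgeSeries_eq (f : ℤ → SPoly) :
    edgeSeries f = PowerSeries.C (f 0) + t * (P₂ * edgeSeries fun d => f (d - 1)) := by
  ext1 n
  cases n with
  | zero => simp [edgeSeries, t]
  | succ n =>
    rw [map_add, t, P₂, PowerSeries.coeff_succ_X_mul, PowerSeries.coeff_C_mul, edgeSeries,
      edgeSeries, PowerSeries.coeff_mk, PowerSeries.coeff_mk, PowerSeries.coeff_C,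
      if_neg n.succ_ne_zero, zero_add, pow_succ', map_mul, mul_assoc]
    congr 3
    push_cast
    ring

theorem pairSeries_eq (f : ℤ → SPoly) :
    pairSeries f = edgeSeries f + t * (P₁ * pairSeries fun d => f (d + 1)) := by
  ext1 n
  cases n with
  | zero => simp [edgeSeries, pairSeries, t]
  | succ n =>
    rw [map_add, t, P₁, PowerSeries.coeff_succ_X_mul, PowerSeries.coeff_C_mul, edgeSeries,
      pairSeries, pairSeries, PowerSeries.coeff_mk, PowerSeries.coeff_mk, PowerSeries.coeff_mk,
      Finset.Nat.sum_antidiagonal_succ, Finset.mul_sum]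
    refine congrArg₂ (· + ·) ?_ (Finset.sum_congr rfl fun x _ => ?_)
    · rw [pow_zero, one_mul, Nat.cast_zero, zero_sub]
    · rw [← mul_assoc, ← map_mul, ← mul_assoc, ← pow_succ', Nat.cast_succ, sub_add_eq_add_sub]

theorem two_mul_s_mul_edgeSeries {f : ℤ → SPoly}
    (hf : ∀ d, 2 * Polynomial.X * f d = f (d + 1) + f (d - 1)) :
    2 * s * edgeSeries f = edgeSeries (fun d => f (d + 1)) + edgeSeries fun d => f (d - 1) := by
  have h2 : (2 : PowerSeries SPoly) * s = PowerSeries.C (2 * Polynomial.X) := by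
    rw [map_mul, s, map_ofNat]
  ext1 n
  rw [h2, PowerSeries.coeff_C_mul, map_add, edgeSeries, edgeSeries, edgeSeries,
    PowerSeries.coeff_mk, PowerSeries.coeff_mk, PowerSeries.coeff_mk]
  linear_combination Polynomial.C (X 1 ^ n) * hf (-(n : ℤ))

theorem two_mul_s_mul_pairSeries {f : ℤ → SPoly}
    (hf : ∀ d, 2 * Polynomial.X * f d = f (d + 1) + f (d - 1)) :
    2 * s * pairSeries f = pairSeries (fun d => f (d + 1)) + pairSeries fun d => f (d - 1) := by
  have h2 : (2 : PowerSeries SPoly) * s = PowerSeries.C (2 * Polynomial.X) := by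
    rw [map_mul, s, map_ofNat]
  ext1 n
  rw [h2, PowerSeries.coeff_C_mul, map_add, pairSeries, pairSeries, pairSeries,
    PowerSeries.coeff_mk, PowerSeries.coeff_mk, PowerSeries.coeff_mk, Finset.mul_sum,
    ← Finset.sum_add_distrib]
  refine Finset.sum_congr rfl fun x _ => ?_
  linear_combination Polynomial.C (X 0 ^ x.1 * X 1 ^ x.2) * hf ((x.1 : ℤ) - x.2)

theorem mul_edgeSeries {f : ℤ → SPoly}
    (hf : ∀ d, 2 * Polynomial.X * f d = f (d + 1) + f (d - 1)) :
    (1 - 2 * s * t * P₂ + t ^ 2 * P₂ ^ 2) * edgeSeries f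
      = PowerSeries.C (f 0) - t * P₂ * PowerSeries.C (f 1) := by
  have h1 := edgeSeries_eq f
  have h2 := edgeSeries_eq fun d => f (d + 1)
  simp only [sub_add_cancel, zero_add] at h2
  linear_combination h1 - t * P₂ * h2 - t * P₂ * two_mul_s_mul_edgeSeries hf

theorem mul_pairSeries {f : ℤ → SPoly}
    (hf : ∀ d, 2 * Polynomial.X * f d = f (d + 1) + f (d - 1)) :
    (1 - 2 * s * t * P₁ + t ^ 2 * P₁ ^ 2) * pairSeries f
      = edgeSeries f - t * P₁ * edgeSeries fun d => f (d - 1) := by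
  have h1 := pairSeries_eq f
  have h2 := pairSeries_eq fun d => f (d - 1)
  simp only [add_sub_cancel_right] at h2
  linear_combination h1 - t * P₁ * h2 - t * P₁ * two_mul_s_mul_pairSeries hf

/-- Each quadratic factor of `den` encodes the three-term recurrence along one index: the `p_1`
factor collapses the double series to edge series, the `p_2` factor collapses those. Only `f(-1)`,
`f(0)`, `f(1)` survive, so initial values determine the numerator. -/
theorem den_mul_pairSeries {f : ℤ → SPoly}
    (hf : ∀ d, 2 * Polynomial.X * f d = f (d + 1) + f (d - 1)) :
    den * pairSeries f = PowerSeries.C (f 0) - t * P₂ * PowerSeries.C (f 1)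
      - t * P₁ * PowerSeries.C (f (-1)) + t ^ 2 * P₁ * P₂ * PowerSeries.C (f 0) := by
  have h1 := mul_edgeSeries hf
  have h2 := mul_edgeSeries (f := fun d => f (d - 1)) fun d => by
    have h := hf (d - 1)
    rw [sub_add_cancel] at h
    rw [add_sub_cancel_right]
    exact h
  simp only [zero_sub, sub_self] at h2
  rw [den]
  linear_combination (1 - 2 * s * t * P₂ + t ^ 2 * P₂ ^ 2) * mul_pairSeries hf + h1
    - t * P₁ * h2

theorem den_mul_invOfUnit : den * PowerSeries.invOfUnit den 1 = 1 := by
  apply PowerSeries.mul_invOfUnit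
  simp [den, t]

theorem u₁_eq : u₁ = pairSeries fun d => Polynomial.Chebyshev.T _ d := by
  have h := den_mul_pairSeries (f := fun d => Polynomial.Chebyshev.T _ d) fun d => by
    rw [Polynomial.Chebyshev.T_add_one]; ring
  simp only [Polynomial.Chebyshev.T_zero, Polynomial.Chebyshev.T_one,
    Polynomial.Chebyshev.T_neg_one, map_one] at h
  rw [← s] at h
  rw [u₁]
  linear_combination -PowerSeries.invOfUnit den 1 * h
    + (pairSeries fun d => Polynomial.Chebyshev.T _ d) * den_mul_invOfUnit

theorem u₂_eq : u₂ = pairSeries fun d => Polynomial.Chebyshev.U _ (d - 1) := by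
  have h := den_mul_pairSeries (f := fun d => Polynomial.Chebyshev.U _ (d - 1)) fun d => by
    have h := Polynomial.Chebyshev.U_add_one (MvPolynomial (Fin 2) ℝ) (d - 1)
    rw [sub_add_cancel] at h
    rw [add_sub_cancel_right, h]
    ring
  simp only [zero_sub, sub_self, Polynomial.Chebyshev.U_zero, Polynomial.Chebyshev.U_neg_one,
    map_one, map_zero] at h
  rw [show (-1 - 1 : ℤ) = -2 by norm_num, Polynomial.Chebyshev.U_neg_two, map_neg, map_one] at h
  rw [u₂]
  linear_combination -PowerSeries.invOfUnit den 1 * h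
    + (pairSeries fun d => Polynomial.Chebyshev.U _ (d - 1)) * den_mul_invOfUnit

/-- `∑_{k+l=n} c(k - l) p_k(x_a) p_l(x_b)`. -/
def pairSum (κ : ℝ) (a b : Fin N) (n : ℕ) (c : ℤ → ℝ) : MvPolynomial (Fin N) ℝ :=
  ∑ x ∈ Finset.HasAntidiagonal.antidiagonal n, c ((x.1 : ℤ) - x.2) • pp κ a b x.1 x.2

theorem PsiInv_C_mul (κ : ℝ) (a b : Fin N) (k l : ℕ) (c : ℝ) :
    PsiInv κ a b (X 0 ^ k * X 1 ^ l * C c) = c • pp κ a b k l := by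
  have h : (X 0 ^ k * X 1 ^ l * C c : MvPolynomial (Fin 2) ℝ)
      = c • basisMonomials (Fin 2) ℝ (Finsupp.single 0 k + Finsupp.single 1 l) := by
    rw [coe_basisMonomials, smul_eq_C_mul]
    dsimp only
    rw [monomial_single_add, X_pow_eq_monomial (n := 1)]
    ring
  rw [h, map_smul, PsiInv, Module.Basis.constr_basis, pp]
  simp

theorem PsiInv_coeff_pairSeries (κ : ℝ) (a b : Fin N) (f : ℤ → Polynomial ℝ) (n j : ℕ) :
    PsiInv κ a b ((PowerSeries.coeff n (pairSeries fun d => (f d).map C)).coeff j)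
      = pairSum κ a b n fun d => (f d).coeff j := by
  rw [pairSeries, PowerSeries.coeff_mk, Polynomial.finsetSum_coeff, map_sum, pairSum]
  refine Finset.sum_congr rfl fun x _ => ?_
  rw [Polynomial.coeff_C_mul, Polynomial.coeff_map, PsiInv_C_mul]

theorem phi_eq (κ : ℝ) (a b : Fin N) (n j : ℕ) :
    phi κ a b n j = pairSum κ a b n fun d => (Polynomial.Chebyshev.T ℝ d).coeff j := by
  rw [phi, u₁_eq, ← PsiInv_coeff_pairSeries]
  simp only [Polynomial.Chebyshev.map_T]

theorem psi_eq (κ : ℝ) (a b : Fin N) (n j : ℕ) :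
    psi κ a b n j = pairSum κ a b n fun d => (Polynomial.Chebyshev.U ℝ (d - 1)).coeff j := by
  rw [psi, u₂_eq, ← PsiInv_coeff_pairSeries]
  simp only [Polynomial.Chebyshev.map_U]

theorem phi_eq_zero (κ : ℝ) (a b : Fin N) {n j : ℕ} (h : n < j) : phi κ a b n j = 0 := by
  rw [phi_eq, pairSum]
  refine Finset.sum_eq_zero fun x hx => ?_
  rw [Finset.HasAntidiagonal.mem_antidiagonal] at hx
  rw [Polynomial.coeff_eq_zero_of_natDegree_lt, zero_smul]
  rw [Polynomial.Chebyshev.natDegree_T]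
  omega

theorem psi_eq_zero (κ : ℝ) (a b : Fin N) {n j : ℕ} (h : n ≤ j) : psi κ a b n j = 0 := by
  rw [psi_eq, pairSum]
  refine Finset.sum_eq_zero fun x hx => ?_
  rw [Finset.HasAntidiagonal.mem_antidiagonal] at hx
  -- At `k = l` the degree bound is not strict when `j = 0`; there `U_{-1} = 0` is needed.
  rcases eq_or_ne ((x.1 : ℤ) - x.2 - 1) (-1) with h1 | h1
  · rw [h1, Polynomial.Chebyshev.U_neg_one, Polynomial.coeff_zero, zero_smul]
  · rw [Polynomial.coeff_eq_zero_of_natDegree_lt, zero_smul]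
    rw [Polynomial.Chebyshev.natDegree_U]
    omega

/-! ### The Dunkl operators on `φ_{nj}` and `ψ_{nj}` -/

/-- `∑_{k+l=n} c(k - l) (x_a - x_b) δ_k δ_l`. -/
def corrSum (κ : ℝ) (a b : Fin N) (n : ℕ) (c : ℤ → ℝ) : MvPolynomial (Fin N) ℝ :=
  ∑ x ∈ Finset.HasAntidiagonal.antidiagonal n, c ((x.1 : ℤ) - x.2) • corr κ a b x.1 x.2

/-- The product with indices `(k, l)` now comes from `(k + 1, l)`, hence the argument `d + 1`; the
term with `k = 0` contributes only its correction. -/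
theorem dunkl_left_pairSum (κ : ℝ) {a b : Fin N} (h : a ≠ b) (n : ℕ) (c : ℤ → ℝ) :
    dunkl κ a (pairSum κ a b (n + 1) c)
      = ∑ x ∈ Finset.HasAntidiagonal.antidiagonal n,
          ((N * κ + x.1 + 1) * c ((x.1 : ℤ) - x.2 + 1)) • pp κ a b x.1 x.2
        + κ • corrSum κ a b (n + 1) c := by
  rw [pairSum, corrSum, map_sum, Finset.Nat.sum_antidiagonal_succ,
    Finset.Nat.sum_antidiagonal_succ, smul_add, Finset.smul_sum, add_left_comm,
    ← Finset.sum_add_distrib, map_smul, dunkl_left_pp_zero κ h, smul_comm]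
  congr 1
  refine Finset.sum_congr rfl fun x _ => ?_
  rw [map_smul, dunkl_left_pp_succ κ h, smul_add, smul_smul, smul_comm κ, mul_comm]
  push_cast
  rw [sub_add_eq_add_sub]

theorem dunkl_right_pairSum (κ : ℝ) {a b : Fin N} (h : a ≠ b) (n : ℕ) (c : ℤ → ℝ) :
    dunkl κ b (pairSum κ a b (n + 1) c)
      = ∑ x ∈ Finset.HasAntidiagonal.antidiagonal n,
          ((N * κ + x.2 + 1) * c ((x.1 : ℤ) - x.2 - 1)) • pp κ a b x.1 x.2
        - κ • corrSum κ a b (n + 1) c := by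
  rw [pairSum, corrSum, map_sum, Finset.Nat.sum_antidiagonal_succ',
    Finset.Nat.sum_antidiagonal_succ', smul_add, Finset.smul_sum, sub_add_eq_sub_sub_swap,
    ← Finset.sum_sub_distrib, map_smul, dunkl_right_pp_zero κ h, smul_neg,
    smul_comm κ, neg_add_eq_sub]
  congr 1
  refine Finset.sum_congr rfl fun x _ => ?_
  rw [map_smul, dunkl_right_pp_succ κ h, smul_sub, smul_smul, smul_comm κ, mul_comm]
  push_cast
  rw [sub_sub]

/-- The correction is symmetric in `k` and `l`, while `c` is odd. -/
theorem corrSum_eq_zero_of_odd (κ : ℝ) (a b : Fin N) (n : ℕ) {c : ℤ → ℝ}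
    (hc : ∀ d, c (-d) = -c d) : corrSum κ a b n c = 0 := by
  have h : corrSum κ a b n c = -corrSum κ a b n c := by
    conv_lhs => rw [corrSum, ← Finset.Nat.sum_antidiagonal_swap]
    rw [corrSum, ← Finset.sum_neg_distrib]
    refine Finset.sum_congr rfl fun x _ => ?_
    rw [← neg_smul, ← hc, neg_sub, corr_comm]
    rfl
  exact self_eq_neg.1 h

/-- Summation by parts: differences of `e` pass to differences of corrections, which are
antisymmetrised products. Oddness of `e` then gives twice the pair sum. -/
theorem corrSum_succ_eq (κ : ℝ) {a b : Fin N} (h : a ≠ b) (n : ℕ) {c e : ℤ → ℝ}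
    (hc : ∀ d, 2 * c d = e (d + 1) - e (d - 1)) (he : ∀ d, e (-d) = -e d) :
    corrSum κ a b (n + 1) c = pairSum κ a b n e := by
  have h1 : ∑ x ∈ Finset.HasAntidiagonal.antidiagonal n,
      e ((x.1 : ℤ) - x.2) • (pp κ a b x.1 x.2 - pp κ a b x.2 x.1)
        = (2 : ℝ) • pairSum κ a b n e := by
    simp only [smul_sub]
    rw [Finset.sum_sub_distrib, two_smul, pairSum, sub_eq_add_neg, ← Finset.sum_neg_distrib]
    congr 1
    rw [← Finset.Nat.sum_antidiagonal_swap]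
    refine Finset.sum_congr rfl fun x _ => ?_
    rw [← neg_smul, ← he, neg_sub]
    rfl
  have h2 : (2 : ℝ) • corrSum κ a b (n + 1) c = ∑ x ∈ Finset.HasAntidiagonal.antidiagonal n,
      e ((x.1 : ℤ) - x.2) • (pp κ a b x.1 x.2 - pp κ a b x.2 x.1) := by
    have h3 : (2 : ℝ) • corrSum κ a b (n + 1) c
        = ∑ x ∈ Finset.HasAntidiagonal.antidiagonal (n + 1),
            e ((x.1 : ℤ) - x.2 + 1) • corr κ a b x.1 x.2
          - ∑ x ∈ Finset.HasAntidiagonal.antidiagonal (n + 1),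
            e ((x.1 : ℤ) - x.2 - 1) • corr κ a b x.1 x.2 := by
      rw [corrSum, Finset.smul_sum, ← Finset.sum_sub_distrib]
      refine Finset.sum_congr rfl fun x _ => ?_
      rw [smul_smul, hc, sub_smul]
    -- Peeling `l = 0` from one sum and `k = 0` from the other aligns both at `e (k - l)`; the
    -- peeled corrections are zero.
    rw [h3, Finset.Nat.sum_antidiagonal_succ', Finset.Nat.sum_antidiagonal_succ]
    simp only [corr_zero_left κ h, corr_zero_right κ h, smul_zero, zero_add]
    rw [← Finset.sum_sub_distrib]
    refine Finset.sum_congr rfl fun x _ => ?_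
    rw [pp, pp, ← corr_succ_sub_corr_succ κ h, smul_sub]
    congr 3 <;> push_cast <;> ring
  have h4 := h2.trans h1
  exact smul_right_injective _ (two_ne_zero : (2 : ℝ) ≠ 0) h4

theorem pairSum_combination (κ : ℝ) (a b : Fin N) (n : ℕ) (c e : ℤ → ℝ) (α β : ℝ) :
    pairSum κ a b n (fun d => α * c d + β * e d)
      = α • pairSum κ a b n c + β • pairSum κ a b n e := by
  rw [pairSum, pairSum, pairSum, Finset.smul_sum, Finset.smul_sum, ← Finset.sum_add_distrib]
  exact Finset.sum_congr rfl fun x _ => by rw [add_smul, mul_smul, mul_smul]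

theorem pairSum_smul (κ : ℝ) (a b : Fin N) (n : ℕ) (c : ℤ → ℝ) (α : ℝ) :
    pairSum κ a b n (fun d => α * c d) = α • pairSum κ a b n c := by
  rw [pairSum, pairSum, Finset.smul_sum]
  exact Finset.sum_congr rfl fun x _ => by rw [mul_smul]

/-- Here `A = Nκ + k + 1` and `B = Nκ + l + 1`; only their difference and sum enter, so `c'` is a
function of `d` alone. -/
theorem dunkl_add_pairSum (κ : ℝ) {a b : Fin N} (h : a ≠ b) (n : ℕ) {c c' : ℤ → ℝ}
    (hc : ∀ (A B : ℝ) (d : ℤ), A - B = d → A + B = 2 * N * κ + n + 2 →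
      A * c (d + 1) + B * c (d - 1) = c' d) :
    dunkl κ a (pairSum κ a b (n + 1) c) + dunkl κ b (pairSum κ a b (n + 1) c)
      = pairSum κ a b n c' := by
  rw [dunkl_left_pairSum κ h, dunkl_right_pairSum κ h, add_add_sub_cancel,
    ← Finset.sum_add_distrib]
  refine Finset.sum_congr rfl fun x hx => ?_
  rw [Finset.HasAntidiagonal.mem_antidiagonal] at hx
  rw [← add_smul, hc]
  · push_cast; ring
  · rw [← hx]; push_cast; ring

theorem dunkl_sub_pairSum (κ : ℝ) {a b : Fin N} (h : a ≠ b) (n : ℕ) {c c' : ℤ → ℝ}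
    (hc : ∀ (A B : ℝ) (d : ℤ), A - B = d → A + B = 2 * N * κ + n + 2 →
      A * c (d + 1) - B * c (d - 1) = c' d) :
    dunkl κ a (pairSum κ a b (n + 1) c) - dunkl κ b (pairSum κ a b (n + 1) c)
      = pairSum κ a b n c' + (2 * κ) • corrSum κ a b (n + 1) c := by
  have key : ∑ x ∈ Finset.HasAntidiagonal.antidiagonal n,
        ((N * κ + x.1 + 1) * c ((x.1 : ℤ) - x.2 + 1)) • pp κ a b x.1 x.2
      - ∑ x ∈ Finset.HasAntidiagonal.antidiagonal n,
        ((N * κ + x.2 + 1) * c ((x.1 : ℤ) - x.2 - 1)) • pp κ a b x.1 x.2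
      = pairSum κ a b n c' := by
    rw [← Finset.sum_sub_distrib]
    refine Finset.sum_congr rfl fun x hx => ?_
    rw [Finset.HasAntidiagonal.mem_antidiagonal] at hx
    rw [← sub_smul, hc]
    · push_cast; ring
    · rw [← hx]; push_cast; ring
  rw [dunkl_left_pairSum κ h, dunkl_right_pairSum κ h, ← key, two_mul, add_smul]
  abel

theorem corrSum_U (κ : ℝ) (a b : Fin N) (n j : ℕ) :
    corrSum κ a b n (fun d => (Polynomial.Chebyshev.U ℝ (d - 1)).coeff j) = 0 :=
  corrSum_eq_zero_of_odd κ a b n fun d => by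
    rw [Polynomial.Chebyshev.U_neg_sub_one, Polynomial.coeff_neg]

theorem corrSum_T (κ : ℝ) {a b : Fin N} (h : a ≠ b) (n j : ℕ) :
    corrSum κ a b (n + 1) (fun d => (Polynomial.Chebyshev.T ℝ d).coeff j) = psi κ a b n j := by
  rw [psi_eq]
  refine corrSum_succ_eq κ h n (fun d => ?_) fun d => by
    rw [Polynomial.Chebyshev.U_neg_sub_one, Polynomial.coeff_neg]
  rw [add_sub_cancel_right, show d - 1 - 1 = d - 2 by ring, U_self_eq, U_sub_two_eq]
  simp only [Polynomial.coeff_add, Polynomial.coeff_sub]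
  ring

section Action

variable (κ : ℝ) {a b : Fin N}

theorem dunkl_add_phi_zero (h : a ≠ b) (n : ℕ) :
    dunkl κ a (phi κ a b (n + 1) 0) + dunkl κ b (phi κ a b (n + 1) 0) = -phi κ a b n 1 := by
  rw [phi_eq, phi_eq, ← neg_one_smul ℝ, ← pairSum_smul]
  refine dunkl_add_pairSum κ h n fun A B d hd _ => ?_
  have e := congrArg (fun q => Polynomial.coeff q 0) (T_combination_add hd)
  simpa [Polynomial.coeff_derivative] using e

theorem dunkl_add_phi_succ (h : a ≠ b) (n j : ℕ) :
    dunkl κ a (phi κ a b (n + 1) (j + 1)) + dunkl κ b (phi κ a b (n + 1) (j + 1))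
      = (2 * N * κ + n + 2 + j) • phi κ a b n j + (-((j : ℝ) + 2)) • phi κ a b n (j + 2) := by
  rw [phi_eq, phi_eq, phi_eq, ← pairSum_combination]
  refine dunkl_add_pairSum κ h n fun A B d hd hAB => ?_
  have e := congrArg (fun q => Polynomial.coeff q (j + 1)) (T_combination_add hd)
  simp only [Polynomial.coeff_add, Polynomial.coeff_sub, Polynomial.coeff_C_mul,
    Polynomial.coeff_X_mul, coeff_X_mul_derivative, Polynomial.coeff_derivative, hAB] at e
  rw [e]
  push_cast
  ring

theorem dunkl_add_psi_zero (h : a ≠ b) (n : ℕ) :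
    dunkl κ a (psi κ a b (n + 1) 0) + dunkl κ b (psi κ a b (n + 1) 0) = -psi κ a b n 1 := by
  rw [psi_eq, psi_eq, ← neg_one_smul ℝ, ← pairSum_smul]
  refine dunkl_add_pairSum κ h n fun A B d hd _ => ?_
  have e := congrArg (fun q => Polynomial.coeff q 0) (U_combination_add hd)
  rw [add_sub_cancel_right, show d - 1 - 1 = d - 2 by ring]
  simpa [Polynomial.coeff_derivative] using e

theorem dunkl_add_psi_succ (h : a ≠ b) (n j : ℕ) :
    dunkl κ a (psi κ a b (n + 1) (j + 1)) + dunkl κ b (psi κ a b (n + 1) (j + 1))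
      = (2 * N * κ + n + 3 + j) • psi κ a b n j + (-((j : ℝ) + 2)) • psi κ a b n (j + 2) := by
  rw [psi_eq, psi_eq, psi_eq, ← pairSum_combination]
  refine dunkl_add_pairSum κ h n fun A B d hd hAB => ?_
  have e := congrArg (fun q => Polynomial.coeff q (j + 1)) (U_combination_add hd)
  rw [add_sub_cancel_right, show d - 1 - 1 = d - 2 by ring]
  simp only [Polynomial.coeff_add, Polynomial.coeff_sub, Polynomial.coeff_C_mul,
    Polynomial.coeff_X_mul, coeff_X_mul_derivative, Polynomial.coeff_derivative, hAB] at e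
  rw [e]
  push_cast
  ring

/-- Diagonal in `j`, because `U_combination_sub` gives a constant plus the Euler operator `s d/ds`,
and the corrections vanish. -/
theorem dunkl_sub_psi (h : a ≠ b) (n j : ℕ) :
    dunkl κ a (psi κ a b (n + 1) j) - dunkl κ b (psi κ a b (n + 1) j)
      = (2 * N * κ + n + 2 + j) • phi κ a b n j := by
  rw [psi_eq, phi_eq, ← pairSum_smul]
  rw [dunkl_sub_pairSum κ h n
    (c' := fun d => (2 * N * κ + n + 2 + j) * (Polynomial.Chebyshev.T ℝ d).coeff j),
    corrSum_U, smul_zero, add_zero]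
  intro A B d hd hAB
  have e := congrArg (fun q => Polynomial.coeff q j) (U_combination_sub hd)
  rw [add_sub_cancel_right, show d - 1 - 1 = d - 2 by ring]
  simp only [Polynomial.coeff_add, Polynomial.coeff_sub, Polynomial.coeff_C_mul,
    coeff_X_mul_derivative, hAB] at e
  rw [e]
  ring

theorem dunkl_sub_phi_of_lt_two (h : a ≠ b) (n : ℕ) {j : ℕ} (hj : j < 2) :
    dunkl κ a (phi κ a b (n + 1) j) - dunkl κ b (phi κ a b (n + 1) j)
      = (-(2 * N * κ - 2 * κ + n + 2 + j)) • psi κ a b n j := by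
  rw [phi_eq, dunkl_sub_pairSum κ h n
    (c' := fun d => (-(2 * N * κ + n + 2 + j)) * (Polynomial.Chebyshev.U ℝ (d - 1)).coeff j),
    corrSum_T κ h, pairSum_smul, ← psi_eq, ← add_smul]
  · congr 1
    ring
  · intro A B d hd hAB
    have e := congrArg (fun q => Polynomial.coeff q j) (T_combination_sub hd)
    obtain rfl | rfl : j = 0 ∨ j = 0 + 1 := by omega
    · simp only [Polynomial.coeff_sub, Polynomial.coeff_C_mul, Polynomial.coeff_X_mul_zero,
        hAB] at e
      rw [e]
      push_cast
      ring
    · simp only [Polynomial.coeff_sub, Polynomial.coeff_C_mul, Polynomial.coeff_X_mul,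
        Polynomial.coeff_X_mul_zero, Polynomial.coeff_derivative, hAB] at e
      rw [e]
      push_cast
      ring

/-- The correction adds `2κ ψ_{n,j+2}`, which changes `2Nκ` into `2Nκ - 2κ` in the second
coefficient; this is the origin of the parameter `Nκ - κ`. -/
theorem dunkl_sub_phi_add_two (h : a ≠ b) (n j : ℕ) :
    dunkl κ a (phi κ a b (n + 1) (j + 2)) - dunkl κ b (phi κ a b (n + 1) (j + 2))
      = (2 * N * κ + n + 3 + j) • psi κ a b n j
        + (-(2 * N * κ - 2 * κ + n + 4 + j)) • psi κ a b n (j + 2) := by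
  rw [phi_eq, dunkl_sub_pairSum κ h n
    (c' := fun d => (2 * N * κ + n + 3 + j) * (Polynomial.Chebyshev.U ℝ (d - 1)).coeff j
      + (-(2 * N * κ + n + 4 + j)) * (Polynomial.Chebyshev.U ℝ (d - 1)).coeff (j + 2)),
    corrSum_T κ h, pairSum_combination, ← psi_eq, ← psi_eq, add_assoc, ← add_smul]
  · congr 2
    ring
  · intro A B d hd hAB
    have e := congrArg (fun q => Polynomial.coeff q (j + 2)) (T_combination_sub hd)
    simp only [Polynomial.coeff_sub, Polynomial.coeff_C_mul, Polynomial.coeff_X_mul,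
      coeff_X_mul_derivative, Polynomial.coeff_derivative, hAB] at e
    rw [e]
    push_cast
    ring

end Action

/-! ### The polynomials `g_n^o`, `g_n^e` and Pochhammer symbols -/

theorem gOdd_add_two (v : ℝ) (n : ℕ) :
    gOdd v (n + 2) = (v + 3 * ((n : ℝ) + 1) + 1) * gOdd v (n + 1)
      - ((n : ℝ) + 1) * (2 * ((n : ℝ) + 1) - 1) * gOdd v n := rfl

theorem gEven_add_two (v : ℝ) (n : ℕ) :
    gEven v (n + 2) = (v + 3 * ((n : ℝ) + 1) + 2) * gEven v (n + 1)
      - ((n : ℝ) + 1) * (2 * ((n : ℝ) + 1) + 1) * gEven v n := rfl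

/-- By the recurrence of `g^e`, the right side obeys the recurrence of `g^o`; two initial values
suffice. Together with `gEven_succ_sub`, proved likewise, it yields the remaining contiguous
relations algebraically. -/
theorem gOdd_succ_eq_gEven_sub (v : ℝ) (j : ℕ) :
    gOdd v (j + 1) = gEven v (j + 1) - (j + 1) * gEven v j := by
  induction j using Nat.strong_induction_on with
  | _ j ih =>
    match j with
    | 0 => simp only [gOdd, gEven]; push_cast; ring
    | 1 => simp only [gOdd, gEven]; push_cast; ring
    | j + 2 =>
      rw [gOdd_add_two, ih (j + 1) (by omega), ih j (by omega), gEven_add_two v (j + 1),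
        gEven_add_two v j]
      push_cast
      ring

theorem gOdd_succ_sub (v : ℝ) (j : ℕ) :
    gOdd v (j + 1) - (2 * j + 1) * gOdd v j = v * gEven v j := by
  match j with
  | 0 => simp only [gOdd, gEven]; push_cast; ring
  | j + 1 =>
    rw [gOdd_succ_eq_gEven_sub, gOdd_succ_eq_gEven_sub, gEven_add_two]
    push_cast
    ring

theorem gEven_succ_sub (v : ℝ) (j : ℕ) :
    gEven v (j + 1) - 2 * (j + 1) * gEven v j = gOdd (v - 1) (j + 1) := by
  induction j using Nat.strong_induction_on with
  | _ j ih =>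
    match j with
    | 0 => simp only [gOdd, gEven]; push_cast; ring
    | 1 => simp only [gOdd, gEven]; push_cast; ring
    | j + 2 =>
      rw [gOdd_add_two, ← ih (j + 1) (by omega), ← ih j (by omega), gEven_add_two v (j + 1),
        gEven_add_two v j]
      push_cast
      ring

theorem gOdd_succ_sub_eq_neg (v : ℝ) (j : ℕ) :
    gOdd v (j + 1) - (2 * v + 2 * j + 1) * gOdd v j = -v * gOdd (v - 1) j := by
  match j with
  | 0 => simp only [gOdd]; push_cast; ring
  | j + 1 =>
    rw [← gEven_succ_sub, gOdd_succ_eq_gEven_sub, gOdd_succ_eq_gEven_sub, gEven_add_two]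
    push_cast
    ring

theorem gEven_succ_sub_eq_neg (v : ℝ) (j : ℕ) :
    gEven (v + 1) (j + 1) - (2 * v + 2 * j + 3) * gEven (v + 1) j = -v * gEven v j := by
  match j with
  | 0 => simp only [gEven]; push_cast; ring
  | j + 1 =>
    have h1 := gOdd_succ_sub v (j + 1)
    have h2 := gEven_succ_sub (v + 1) (j + 1)
    have h3 := gEven_succ_sub (v + 1) j
    rw [add_sub_cancel_right] at h2 h3
    rw [← h2, ← h3] at h1
    rw [gEven_add_two] at h1 ⊢
    push_cast at h1 ⊢
    linear_combination -h1

theorem poch_succ (x : ℝ) (j : ℕ) : poch x (j + 1) = poch x j * (x + j) := by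
  simp [poch, ascPochhammer_succ_eval]

theorem poch_succ_left (x : ℝ) (j : ℕ) : poch x (j + 1) = x * poch (x + 1) j := by
  simp [poch, ascPochhammer_succ_left, Polynomial.eval_comp]

theorem poch_pos {x : ℝ} (hx : 0 < x) (j : ℕ) : 0 < poch x j := ascPochhammer_pos j x hx

/-- The coefficient `2^{-j} γ / (x)_j`. -/
def wt (x γ : ℝ) (j : ℕ) : ℝ := (1 / 2) ^ j * γ / poch x j

/-- The Dunkl action produces exactly the factor `2 (x + j)`, which `2^{-j} / (x)_j` absorbs. -/
theorem wt_succ_mul {x : ℝ} (hx : 0 < x) (γ : ℝ) (j : ℕ) :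
    wt x γ (j + 1) * (2 * (x + j)) = wt x γ j := by
  have h1 := (poch_pos hx j).ne'
  have h2 : x + j ≠ 0 := by positivity
  rw [wt, wt, poch_succ]
  field_simp
  ring

theorem wt_add_one_mul {x : ℝ} (hx : 0 < x) (γ : ℝ) (j : ℕ) :
    wt (x + 1) γ j * (2 * (x + j)) = 2 * x * wt x γ j := by
  have h1 := (poch_pos hx j).ne'
  have h2 := (poch_pos (by positivity : 0 < x + 1) j).ne'
  have h3 := poch_succ x j
  rw [poch_succ_left] at h3
  rw [wt, wt, div_mul_eq_mul_div, ← mul_div_assoc, div_eq_div_iff h2 h1]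
  linear_combination -2 * (1 / 2) ^ j * γ * h3

theorem wt_add_one_eq {x : ℝ} (hx : 0 < x) (γ : ℝ) (j : ℕ) :
    wt (x + 1) γ j = 2 * x * wt x γ (j + 1) := by
  have h2 := (poch_pos (by positivity : 0 < x + 1) j).ne'
  rw [wt, wt, poch_succ_left]
  field_simp
  ring

theorem wt_linear (x γ γ' c : ℝ) (j : ℕ) : wt x (γ - c * γ') j = wt x γ j - c * wt x γ' j := by
  rw [wt, wt, wt]
  ring

theorem wt_mul (x γ c : ℝ) (j : ℕ) : wt x (c * γ) j = c * wt x γ j := by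
  rw [wt, wt]
  ring

/-! ### The polynomials `h_n^±` -/

theorem hMinus_odd (κ : ℝ) (a b : Fin N) (m : ℕ) :
    hMinus κ a b (2 * m + 1) = ∑ j ∈ Finset.range (m + 1),
      wt (N * κ + m + 2) (gOdd (N * κ - κ + m) j) j • psi κ a b (2 * m + 1) (2 * j) := by
  have h1 : (2 * m + 1) / 2 = m := by omega
  have h2 : ¬ Even (2 * m + 1) := by simp
  simp only [hMinus, h1, if_neg h2, smul_eq_C_mul, wt]

theorem hMinus_even (κ : ℝ) (a b : Fin N) (m : ℕ) :
    hMinus κ a b (2 * m) = ∑ j ∈ Finset.range m,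
      wt (N * κ + m + 2) (gEven (N * κ - κ + m) j) j • psi κ a b (2 * m) (2 * j + 1) := by
  have h1 : 2 * m / 2 = m := by omega
  have h2 : Even (2 * m) := by simp
  simp only [hMinus, h1, if_pos h2, smul_eq_C_mul, wt]

theorem hPlus_odd (κ : ℝ) (a b : Fin N) (m : ℕ) :
    hPlus κ a b (2 * m + 1) = ∑ j ∈ Finset.range (m + 1),
      wt (N * κ + m + 2) (gEven (N * κ - κ + m + 1) j) j
        • phi κ a b (2 * m + 1) (2 * j + 1) := by
  have h1 : (2 * m + 1) / 2 = m := by omega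
  have h2 : ¬ Even (2 * m + 1) := by simp
  simp only [hPlus, h1, if_neg h2, smul_eq_C_mul, wt]

theorem hPlus_even (κ : ℝ) (a b : Fin N) (m : ℕ) :
    hPlus κ a b (2 * m) = ∑ j ∈ Finset.range (m + 1),
      wt (N * κ + m + 1) (gOdd (N * κ - κ + m) j) j • phi κ a b (2 * m) (2 * j) := by
  have h1 : 2 * m / 2 = m := by omega
  have h2 : Even (2 * m) := by simp
  simp only [hPlus, h1, if_pos h2, smul_eq_C_mul, wt]

/-! ### Operators with two-term action on weighted sums -/

section LinearCombinations

variable {M : Type*} [AddCommGroup M] [Module ℝ M] (L : M →ₗ[ℝ] M) {f χ : ℕ → M}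
  {c e : ℕ → ℝ} {r : ℝ}

theorem map_sum_diagonal {α : ℕ → ℝ} (hf : ∀ j, L (f j) = α j • χ j)
    (hc : ∀ j, c j * α j = r * e j) (m : ℕ) :
    L (∑ j ∈ Finset.range m, c j • f j) = r • ∑ j ∈ Finset.range m, e j • χ j := by
  rw [map_sum, Finset.smul_sum]
  refine Finset.sum_congr rfl fun j _ => ?_
  rw [map_smul, hf, smul_smul, smul_smul, hc]

theorem map_sum_lower {α β : ℕ → ℝ} (h0 : L (f 0) = (-β 0) • χ 0)
    (hf : ∀ j, L (f (j + 1)) = α j • χ j + (-β (j + 1)) • χ (j + 1))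
    (hc : ∀ j, c (j + 1) * α j - c j * β j = r * e j) {m : ℕ} (hm : χ m = 0) :
    L (∑ j ∈ Finset.range (m + 1), c j • f j) = r • ∑ j ∈ Finset.range m, e j • χ j := by
  -- The partial sums leave a remainder at the top index; it is removed only at the final `m`, where
  -- `χ m = 0`.
  have key : ∀ m, L (∑ j ∈ Finset.range (m + 1), c j • f j)
      = r • ∑ j ∈ Finset.range m, e j • χ j - (c m * β m) • χ m := by
    intro m
    induction m with
    | zero => simp [h0, smul_smul]
    | succ m ih =>
      rw [Finset.sum_range_succ, map_add, ih, Finset.sum_range_succ _ m, smul_add, map_smul, hf,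
        smul_smul r, ← hc]
      module
  rw [key, hm, smul_zero, sub_zero]

theorem map_sum_upper {α β : ℕ → ℝ}
    (hf : ∀ j, L (f j) = α j • χ j + (-β j) • χ (j + 1))
    (h0 : c 0 * α 0 = r * e 0)
    (hc : ∀ j, c (j + 1) * α (j + 1) - c j * β j = r * e (j + 1)) {m : ℕ}
    (hm : χ (m + 1) = 0) :
    L (∑ j ∈ Finset.range (m + 1), c j • f j)
      = r • ∑ j ∈ Finset.range (m + 1), e j • χ j := by
  have key : ∀ m, L (∑ j ∈ Finset.range (m + 1), c j • f j)
      = r • ∑ j ∈ Finset.range (m + 1), e j • χ j - (c m * β m) • χ (m + 1) := by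
    intro m
    induction m with
    | zero =>
      rw [Finset.sum_range_one, Finset.sum_range_one, map_smul, hf, smul_smul r, ← h0]
      module
    | succ m ih =>
      rw [Finset.sum_range_succ, map_add, ih, Finset.sum_range_succ _ (m + 1), smul_add,
        map_smul, hf, smul_smul r, ← hc]
      module
  rw [key, hm, smul_zero, sub_zero]

end LinearCombinations

/-! ### The eight ladder relations -/

section Ladder

variable {κ : ℝ} {a b : Fin N}

theorem dunkl_sub_hMinus_odd (h : a ≠ b) (hκ : 0 < N * κ + 1) (m : ℕ) :
    (dunkl κ a - dunkl κ b) (hMinus κ a b (2 * m + 1))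
      = (2 * (N * κ + m + 1)) • hPlus κ a b (2 * m) := by
  have hx : 0 < N * κ + m + 1 := by have := m.cast_nonneg (α := ℝ); linarith
  rw [hMinus_odd, hPlus_even]
  refine map_sum_diagonal (α := fun j => 2 * (N * κ + m + 1 + j)) _ (fun j => ?_) (fun j => ?_) _
  · refine (dunkl_sub_psi κ h (2 * m) (2 * j)).trans ?_
    congr 1
    push_cast
    ring
  · rw [← wt_add_one_mul hx, show N * κ + m + 1 + 1 = N * κ + m + 2 by ring]

theorem dunkl_sub_hMinus_even (h : a ≠ b) (hκ : 0 < N * κ + 1) (m : ℕ) :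
    (dunkl κ a - dunkl κ b) (hMinus κ a b (2 * (m + 1)))
      = (2 * (N * κ + m + 2)) • hPlus κ a b (2 * m + 1) := by
  have hx : 0 < N * κ + m + 2 := by have := m.cast_nonneg (α := ℝ); linarith
  rw [hMinus_even, hPlus_odd]
  refine map_sum_diagonal (α := fun j => 2 * (N * κ + m + 2 + j)) _ (fun j => ?_) (fun j => ?_) _
  · refine (dunkl_sub_psi κ h (2 * m + 1) (2 * j + 1)).trans ?_
    congr 1
    push_cast
    ring
  · rw [← wt_add_one_mul hx]
    push_cast
    rw [show N * κ + (m + 1 : ℝ) + 2 = N * κ + m + 2 + 1 by ring, add_assoc (N * κ - κ)]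

theorem dunkl_add_hMinus_odd (h : a ≠ b) (hκ : 0 < N * κ + 1) (m : ℕ) :
    (dunkl κ a + dunkl κ b) (hMinus κ a b (2 * m + 1))
      = (N * κ - κ + m) • hMinus κ a b (2 * m) := by
  have hx : 0 < N * κ + m + 2 := by have := m.cast_nonneg (α := ℝ); linarith
  rw [hMinus_odd, hMinus_even]
  refine map_sum_lower (α := fun j => 2 * (N * κ + m + 2 + j)) (β := fun j => 2 * j + 1) _
    ?_ (fun j => ?_) (fun j => ?_) (psi_eq_zero κ a b (by omega))
  · refine (dunkl_add_psi_zero κ h (2 * m)).trans ?_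
    simp
  · refine (dunkl_add_psi_succ κ h (2 * m) (2 * j + 1)).trans ?_
    congr 2 <;> push_cast <;> ring
  · rw [wt_succ_mul hx, mul_comm (wt _ _ j), ← wt_linear, gOdd_succ_sub, wt_mul]

theorem dunkl_add_hMinus_even (h : a ≠ b) (hκ : 0 < N * κ + 1) (m : ℕ) :
    (dunkl κ a + dunkl κ b) (hMinus κ a b (2 * (m + 1)))
      = (2 * (N * κ + m + 2)) • hMinus κ a b (2 * m + 1) := by
  have hx : 0 < N * κ + m + 2 := by have := m.cast_nonneg (α := ℝ); linarith
  have hv : N * κ - κ + (m + 1 : ℝ) - 1 = N * κ - κ + m := by ring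
  rw [hMinus_odd, hMinus_even]
  push_cast
  rw [show N * κ + (m + 1 : ℝ) + 2 = N * κ + m + 2 + 1 by ring]
  refine map_sum_upper (α := fun j => 2 * (N * κ + m + 2 + j)) (β := fun j => 2 * (j + 1)) _
    (fun j => ?_) ?_ (fun j => ?_) (psi_eq_zero κ a b (by omega))
  · refine (dunkl_add_psi_succ κ h (2 * m + 1) (2 * j)).trans ?_
    congr 2 <;> push_cast <;> ring
  · rw [wt_add_one_mul hx]; rfl
  -- Both weights are brought to the parameter `x = Nκ + m + 2`, leaving the contiguous relation
  -- from `g^e` at `v` to `g^o` at `v - 1`.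
  · rw [wt_add_one_mul hx, wt_add_one_eq hx, ← hv, ← gEven_succ_sub, wt_linear]
    ring

theorem dunkl_sub_hPlus_odd (h : a ≠ b) (hκ : 0 < N * κ + 1) (m : ℕ) :
    (dunkl κ a - dunkl κ b) (hPlus κ a b (2 * m + 1))
      = (-(N * κ - κ + m)) • hMinus κ a b (2 * m) := by
  have hx : 0 < N * κ + m + 2 := by have := m.cast_nonneg (α := ℝ); linarith
  rw [hPlus_odd, hMinus_even]
  refine map_sum_lower (α := fun j => 2 * (N * κ + m + 2 + j))
    (β := fun j => 2 * (N * κ - κ + m) + 2 * j + 3) _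
    ?_ (fun j => ?_) (fun j => ?_) (psi_eq_zero κ a b (by omega))
  · refine (dunkl_sub_phi_of_lt_two κ h (2 * m) one_lt_two).trans ?_
    congr 1
    push_cast
    ring
  · refine (dunkl_sub_phi_add_two κ h (2 * m) (2 * j + 1)).trans ?_
    congr 2 <;> push_cast <;> ring
  · rw [wt_succ_mul hx, mul_comm (wt _ _ j), ← wt_linear, gEven_succ_sub_eq_neg, wt_mul]

theorem dunkl_sub_hPlus_even (h : a ≠ b) (hκ : 0 < N * κ + 1) (m : ℕ) :
    (dunkl κ a - dunkl κ b) (hPlus κ a b (2 * (m + 1)))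
      = (-(N * κ - κ + (m + 1))) • hMinus κ a b (2 * m + 1) := by
  have hx : 0 < N * κ + m + 2 := by have := m.cast_nonneg (α := ℝ); linarith
  have hv : N * κ - κ + (m + 1 : ℝ) - 1 = N * κ - κ + m := by ring
  rw [hPlus_even, hMinus_odd]
  push_cast
  rw [show N * κ + (m + 1 : ℝ) + 1 = N * κ + m + 2 by ring]
  refine map_sum_lower (α := fun j => 2 * (N * κ + m + 2 + j))
    (β := fun j => 2 * (N * κ - κ + (m + 1)) + 2 * j + 1) _
    ?_ (fun j => ?_) (fun j => ?_) (psi_eq_zero κ a b (by omega))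
  · refine (dunkl_sub_phi_of_lt_two κ h (2 * m + 1) two_pos).trans ?_
    congr 1
    push_cast
    ring
  · refine (dunkl_sub_phi_add_two κ h (2 * m + 1) (2 * j)).trans ?_
    congr 2 <;> push_cast <;> ring
  · rw [wt_succ_mul hx, mul_comm (wt _ _ j), ← wt_linear, gOdd_succ_sub_eq_neg, wt_mul, hv]

theorem dunkl_add_hPlus_odd (h : a ≠ b) (hκ : 0 < N * κ + 1) (m : ℕ) :
    (dunkl κ a + dunkl κ b) (hPlus κ a b (2 * m + 1))
      = (2 * (N * κ + m + 1)) • hPlus κ a b (2 * m) := by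
  have hx : 0 < N * κ + m + 1 := by have := m.cast_nonneg (α := ℝ); linarith
  rw [hPlus_odd, hPlus_even, show N * κ + (m : ℝ) + 2 = N * κ + m + 1 + 1 by ring]
  refine map_sum_upper (α := fun j => 2 * (N * κ + m + 1 + j)) (β := fun j => 2 * (j + 1)) _
    (fun j => ?_) ?_ (fun j => ?_) (phi_eq_zero κ a b (by omega))
  · refine (dunkl_add_phi_succ κ h (2 * m) (2 * j)).trans ?_
    congr 2 <;> push_cast <;> ring
  · rw [wt_add_one_mul hx]; rfl
  · rw [wt_add_one_mul hx, wt_add_one_eq hx, ← add_sub_cancel_right (N * κ - κ + m) 1,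
      ← gEven_succ_sub, wt_linear, sub_add_cancel]
    ring

theorem dunkl_add_hPlus_even (h : a ≠ b) (hκ : 0 < N * κ + 1) (m : ℕ) :
    (dunkl κ a + dunkl κ b) (hPlus κ a b (2 * (m + 1)))
      = (N * κ - κ + (m + 1)) • hPlus κ a b (2 * m + 1) := by
  have hx : 0 < N * κ + m + 2 := by have := m.cast_nonneg (α := ℝ); linarith
  rw [hPlus_even, hPlus_odd]
  push_cast
  rw [show N * κ + (m + 1 : ℝ) + 1 = N * κ + m + 2 by ring]
  refine map_sum_lower (α := fun j => 2 * (N * κ + m + 2 + j)) (β := fun j => 2 * j + 1) _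
    ?_ (fun j => ?_) (fun j => ?_) (phi_eq_zero κ a b (by omega))
  · refine (dunkl_add_phi_zero κ h (2 * m + 1)).trans ?_
    simp
  · refine (dunkl_add_phi_succ κ h (2 * m + 1) (2 * j + 1)).trans ?_
    congr 2 <;> push_cast <;> ring
  · rw [wt_succ_mul hx, mul_comm (wt _ _ j), ← wt_linear, gOdd_succ_sub, wt_mul,
      add_assoc (N * κ - κ)]

end Ladder

end PlanarDunkl
end

theorem mainTheorem2 (N : ℕ) (hN : 2 ≤ N) (κ : ℝ) (hκ : -1 / (N : ℝ) < κ) :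
    let a : Fin N := ⟨0, by omega⟩
    let b : Fin N := ⟨1, by omega⟩
    let T₁ := PlanarDunkl.T κ a
    let T₂ := PlanarDunkl.T κ b
    let hm := PlanarDunkl.hMinus κ a b
    let hp := PlanarDunkl.hPlus κ a b
    (∀ m : ℕ,
      T₁ (hm (2 * m + 1)) - T₂ (hm (2 * m + 1)) = (2 * (N * κ + m + 1)) • hp (2 * m)) ∧
    (∀ m : ℕ, 1 ≤ m →
      T₁ (hm (2 * m)) - T₂ (hm (2 * m)) = (2 * (N * κ + m + 1)) • hp (2 * m - 1)) ∧
    (∀ m : ℕ,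
      T₁ (hm (2 * m + 1)) + T₂ (hm (2 * m + 1)) = (N * κ - κ + m) • hm (2 * m)) ∧
    (∀ m : ℕ, 1 ≤ m →
      T₁ (hm (2 * m)) + T₂ (hm (2 * m)) = (2 * (N * κ + m + 1)) • hm (2 * m - 1)) ∧
    (∀ m : ℕ,
      T₁ (hp (2 * m + 1)) - T₂ (hp (2 * m + 1)) = (-(N * κ - κ + m)) • hm (2 * m)) ∧
    (∀ m : ℕ, 1 ≤ m →
      T₁ (hp (2 * m)) - T₂ (hp (2 * m)) = (-(N * κ - κ + m)) • hm (2 * m - 1)) ∧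
    (∀ m : ℕ,
      T₁ (hp (2 * m + 1)) + T₂ (hp (2 * m + 1)) = (2 * (N * κ + m + 1)) • hp (2 * m)) ∧
    (∀ m : ℕ, 1 ≤ m →
      T₁ (hp (2 * m)) + T₂ (hp (2 * m)) = (N * κ - κ + m) • hp (2 * m - 1)) := by
  intro a b T₁ T₂ hm hp
  have hab : a ≠ b := by simp [a, b]
  have hpos : 0 < N * κ + 1 := by
    have hN' : (0 : ℝ) < N := by positivity
    rw [div_lt_iff₀ hN'] at hκ
    linarith
  -- Writing `m = k + 1` removes the truncated subtraction in `2 * m - 1`.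
  have hpred : ∀ k : ℕ, 2 * (k + 1) - 1 = 2 * k + 1 := fun k => by omega
  have hcast : ∀ k : ℕ, N * κ + ((k + 1 : ℕ) : ℝ) + 1 = N * κ + k + 2 := fun k => by
    push_cast; ring
  refine ⟨PlanarDunkl.dunkl_sub_hMinus_odd hab hpos, ?_,
    PlanarDunkl.dunkl_add_hMinus_odd hab hpos, ?_,
    PlanarDunkl.dunkl_sub_hPlus_odd hab hpos, ?_,
    PlanarDunkl.dunkl_add_hPlus_odd hab hpos, ?_⟩ <;> intro m hm1 <;>
    obtain ⟨k, rfl⟩ := Nat.exists_eq_add_of_le' hm1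
  · rw [hpred, hcast]
    exact PlanarDunkl.dunkl_sub_hMinus_even hab hpos k
  · rw [hpred, hcast]
    exact PlanarDunkl.dunkl_add_hMinus_even hab hpos k
  · rw [hpred, Nat.cast_succ]
    exact PlanarDunkl.dunkl_sub_hPlus_even hab hpos k
  · rw [hpred, Nat.cast_succ]
    exact PlanarDunkl.dunkl_add_hPlus_even hab hpos k
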